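/- **Setting.** Let $\omega\subset\mathbb R^2$ be a bounded Lipschitz domain, $d:\overline\omega\to[0,\infty)$ Lipschitz, $\Omega=\{(x_1,x_2,x_3):(x_1,x_2)\in\omega,\ 0<x_3<d(x_1,x_2)\}$, and let $\Gamma_A=\Gamma_U\cup\Gamma_L$ be the union of the upper boundary $\Gamma_U=\{(x_1,x_2)\in\omega,\ x_3=d(x_1,x_2)\}$ and the lateral boundary $\Gamma_L=\{(x_1,x_2)\in\partial\omega,\ 0\le x_3\le d(x_1,x_2)\}$; $\Gamma_G$ is the remaining (ground) part of $\partial\Omega$, in $x_3=0$. For $k=1,2$ let $H^k_{\Gamma_A}(\Omega)$ be the closure in $H^k(\Omega)$ of the functions in $C^\infty(\overline\Omega)$ vanishing in a neighbourhood of $\Gamma_A$, let $H^1_0(\Omega)$ be the closure of $C_c^\infty(\Omega)$ in $H^1(\Omega)$, and let $\mathbf V=\{\mathbf v\in H^1_{\Gamma_A}(\Omega)\times H^1_{\Gamma_A}(\Omega)\times H^1_0(\Omega):\nabla\cdot\mathbf v=0\}$. Let $T>0$, $\nu_1,\nu_2,\nu_3>0$, $\nabla_\nu=(\nu_1^{1/2}\partial_1,\nu_2^{1/2}\partial_2,\nu_3^{1/2}\partial_3)$,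 let $\mathbf M$ be a constant real $3\times3$ matrix with $(\mathbf M\xi,\xi)\ge\lambda|\xi|^2$ for all $\xi\in\mathbb R^3$ and some $\lambda>0$, let $\alpha=2f\sin(l(x_2))$, $\beta=2f\cos(l(x_2))$ with $f\in\mathbb R$ and $l:\mathbb R\to\mathbb R$ measurable, and put $b(\mathbf u_H)=\alpha(-u_2,u_1)$, where $\mathbf u_H=(u_1,u_2)$. Let $\mathbf u_0\in L^2(\Omega)^3$, $C_0\in L^2(\Omega)$ and $\theta_H\in L^2(0,T;H^{-1/2}(\Gamma_G))^2$, where $H^{-1/2}(\Gamma_G)$ is the dual of the space of traces on $\Gamma_G$ of functions in $H^1_{\Gamma_A}(\Omega)$ (bounded functionals on $H^1_{\Gamma_A}(\Omega)$ that vanish on $H^1_0(\Omega)$). $(\cdot,\cdot)$ is the $L^2(\Omega)$ pairing. For $\varepsilon>0$ and $S^\varepsilon\in L^2(0,T;L^2(\Omega))$, a pair $(\mathbf u^\varepsilon,C^\varepsilon)$ is a *weak solution* of the anisotropic system of the polluted atmosphere if $\mathbf u^\varepsilon\in L^2(0,T;\mathbf V)\cap L^\infty(0,T;L^2(\Omega)^3)$,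 $C^\varepsilon\in L^\infty(0,T;L^2(\Omega))\cap L^2(0,T;H^1_{\Gamma_A}(\Omega))$ and $$\begin{aligned}&\int_0^T\big[-(\mathbf u_H^\varepsilon,\partial_t\tilde{\mathbf u}_H)+(\nabla_\nu\mathbf u_H^\varepsilon,\nabla_\nu\tilde{\mathbf u}_H)-(\mathbf u_H^\varepsilon,(\mathbf u^\varepsilon\cdot\nabla)\tilde{\mathbf u}_H)+(b(\mathbf u_H^\varepsilon),\tilde{\mathbf u}_H)\big]dt+\varepsilon\int_0^T\big[(\beta u_3^\varepsilon,\tilde u_1)-(\beta u_1^\varepsilon,\tilde u_3)\big]dt\\&\quad+\varepsilon^2\int_0^T\big[-(u_3^\varepsilon,\partial_t\tilde u_3)+(\mathbf u^\varepsilon\cdot\nabla u_3^\varepsilon,\tilde u_3)+(\nabla_\nu u_3^\varepsilon,\nabla_\nu\tilde u_3)\big]dt\\&=(\mathbf u_{0H},\tilde{\mathbf u}_H(0))+\varepsilon^2(u_{03},\tilde u_3(0))-\int_0^T\langle\theta_H,\tilde{\mathbf u}_H\rangle_{\Gamma_G}dt,\\[1ex]&\int_0^T\big[-(C^\varepsilon,\partial_t\tilde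 C)-(\mathbf u^\varepsilon C^\varepsilon,\nabla\tilde C)+(\mathbf M\nabla C^\varepsilon,\nabla\tilde C)\big]dt=(C_0,\tilde C(0))+\int_0^T(S^\varepsilon,\tilde C)\,dt\end{aligned}$$ for all $\tilde{\mathbf u}\in H^1(0,T;\mathbf V)$ with $\tilde{\mathbf u}(T)=0$ and all $\tilde C\in H^1(0,T;H^2_{\Gamma_A}(\Omega))$ with $\tilde C(T)=0$. It *satisfies the energy inequality* if for a.e. $t\in(0,T)$ $$\begin{aligned}&\tfrac12\big(\|\mathbf u_H^\varepsilon(t)\|_{L^2}^2+\varepsilon^2\|u_3^\varepsilon(t)\|_{L^2}^2+\|C^\varepsilon(t)\|_{L^2}^2\big)+\int_0^t\big[\|\nabla_\nu\mathbf u_H^\varepsilon\|_{L^2}^2+\varepsilon^2\|\nabla_\nu u_3^\varepsilon\|_{L^2}^2+(\mathbf M\nabla C^\varepsilon,\nabla C^\varepsilon)\big]ds\\&\le\tfrac12\big(\|\mathbf u_{0H}\|_{L^2}^2+\varepsilon^2\|u_{03}\|_{L^2}^2+\|C_0\|_{L^2}^2\big)+\int_0^t|\langle\theta_H,\mathbf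 u_H^\varepsilon\rangle_{\Gamma_G}|\,ds+\int_0^t(S^\varepsilon,C^\varepsilon)\,ds.\end{aligned}$$ **Proposition (time-translation estimate).** Let $\varepsilon_0>0$ and $B\ge0$. There is a constant $c>0$, depending only on $\varepsilon_0$, $B$ and the data $\omega,d,T,\nu,\mathbf M,f,l,\mathbf u_0,C_0,\theta_H$, such that for every $\varepsilon\in(0,\varepsilon_0]$, every source $S^\varepsilon$ with $\|S^\varepsilon\|_{L^2(0,T;L^2(\Omega))}\le B$, every weak solution $(\mathbf u^\varepsilon,C^\varepsilon)$ satisfying the energy inequality, and every $h\in(0,T)$, $$\|\tau_hC^\varepsilon-C^\varepsilon\|_{L^2(0,T-h;(H^2(\Omega))^*)}\le c\,h^{1/4},\qquad \tau_hC^\varepsilon(t)=C^\varepsilon(t+h),$$ where $(H^2(\Omega))^*$ is the dual of $H^2(\Omega)$ and $w\in L^2(\Omega)$ acts on $H^2(\Omega)$ by $\varphi\mapsto(w,\varphi)$. -/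

import Mathlib

open MeasureTheory Set Filter Topology
open scoped ENNReal NNReal ContDiff

noncomputable section

namespace PollutedAtmosphere

/-- The horizontal plane. -/
abbrev E2 := EuclideanSpace ℝ (Fin 2)

/-- Three-dimensional space; the coordinates `0, 1, 2` are `x₁, x₂, x₃` (`x₃` is vertical). -/
abbrev E3 := EuclideanSpace ℝ (Fin 3)

/-! ### Geometry -/

/-- Bounded Lipschitz domain in the plane: a nonempty, open, connected, bounded set which near each
of its boundary points is, after a rigid motion, the region above the graph of a Lipschitz
function. -/
structure IsLipschitzDomain (G : Set E2) : Prop where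
  isOpen : IsOpen G
  isConnected : IsConnected G
  isBounded : Bornology.IsBounded G
  localGraph : ∀ p ∈ frontier G, ∃ (e : E2 ≃ᵃⁱ[ℝ] E2) (γ : ℝ → ℝ) (K : ℝ≥0) (U : Set E2),
    LipschitzWith K γ ∧ IsOpen U ∧ p ∈ U ∧ ∀ q ∈ U, q ∈ G ↔ γ (e q 0) < e q 1

/-- The horizontal part `(x₁, x₂)` of a point. -/
def horiz (p : E3) : E2 := !₂[p 0, p 1]

/-- `Ω = {(x₁, x₂, x₃) : (x₁, x₂) ∈ G, 0 < x₃ < d(x₁, x₂)}`. -/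
def domain (G : Set E2) (d : E2 → ℝ) : Set E3 :=
  {p | horiz p ∈ G ∧ 0 < p 2 ∧ p 2 < d (horiz p)}

/-- The upper boundary `Γ_U`. -/
def upperBdry (G : Set E2) (d : E2 → ℝ) : Set E3 :=
  {p | horiz p ∈ G ∧ p 2 = d (horiz p)}

/-- The lateral boundary `Γ_L`. -/
def lateralBdry (G : Set E2) (d : E2 → ℝ) : Set E3 :=
  {p | horiz p ∈ frontier G ∧ 0 ≤ p 2 ∧ p 2 ≤ d (horiz p)}

/-- `Γ_A = Γ_U ∪ Γ_L`, the boundary above the ground. -/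
def aboveBdry (G : Set E2) (d : E2 → ℝ) : Set E3 :=
  upperBdry G d ∪ lateralBdry G d

/-! ### Sobolev spaces on an open set `Ω ⊆ ℝ³`

An element of a Sobolev space is represented by the tuple of its weak derivatives, all of them in
`L²(Ω)`, with the Euclidean combination of the `L²` norms. -/

/-- `L²(Ω)`. -/
abbrev L2 (Ω : Set E3) := Lp ℝ 2 (volume.restrict Ω)

/-- First order jets: the component `none` is the function, `some i` its derivative `∂ᵢ`. -/
abbrev H1Jet (Ω : Set E3) := PiLp 2 (fun _ : Option (Fin 3) => L2 Ω)

/-- Second order jets: `none` is the function, `some (inl i)` is `∂ᵢ` and `some (inr (i, j))`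
is `∂ᵢ∂ⱼ`. -/
abbrev H2Jet (Ω : Set E3) := PiLp 2 (fun _ : Option (Fin 3 ⊕ Fin 3 × Fin 3) => L2 Ω)

variable {Ω : Set E3}

/-- The function underlying a first order jet. -/
def val (J : H1Jet Ω) : L2 Ω := J none

/-- The `i`-th partial derivative in a first order jet. -/
def grad (J : H1Jet Ω) (i : Fin 3) : L2 Ω := J (some i)

/-- The function underlying a second order jet. -/
def val₂ (J : H2Jet Ω) : L2 Ω := J none

/-- The `i`-th partial derivative in a second order jet. -/
def grad₂ (J : H2Jet Ω) (i : Fin 3) : L2 Ω := J (some (Sum.inl i))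

/-- The second derivative `∂ᵢ∂ⱼ` in a second order jet. -/
def hess₂ (J : H2Jet Ω) (i j : Fin 3) : L2 Ω := J (some (Sum.inr (i, j)))

/-- Classical partial derivative `∂ᵢ φ`. -/
def pderiv (i : Fin 3) (φ : E3 → ℝ) (x : E3) : ℝ := fderiv ℝ φ x (EuclideanSpace.single i 1)

/-- `φ ∈ C_c^∞(Ω)`. -/
def IsTestFunction (Ω : Set E3) (φ : E3 → ℝ) : Prop :=
  ContDiff ℝ ∞ φ ∧ HasCompactSupport φ ∧ tsupport φ ⊆ Ω

/-- `g` is the weak derivative `∂ᵢ v` on `Ω`. -/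
def IsWeakDeriv (i : Fin 3) (v g : L2 Ω) : Prop :=
  ∀ φ : E3 → ℝ, IsTestFunction Ω φ →
    ∫ x in Ω, v x * pderiv i φ x = - ∫ x in Ω, g x * φ x

/-- `J` is the first order jet on `Ω` of the smooth function `φ`. -/
def IsH1JetOf (φ : E3 → ℝ) (J : H1Jet Ω) : Prop :=
  val J =ᵐ[volume.restrict Ω] φ ∧ ∀ i, grad J i =ᵐ[volume.restrict Ω] pderiv i φ

/-- `J` is the second order jet on `Ω` of the smooth function `φ`. -/
def IsH2JetOf (φ : E3 → ℝ) (J : H2Jet Ω) : Prop :=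
  val₂ J =ᵐ[volume.restrict Ω] φ ∧ (∀ i, grad₂ J i =ᵐ[volume.restrict Ω] pderiv i φ) ∧
    ∀ i j, hess₂ J i j =ᵐ[volume.restrict Ω] pderiv i (pderiv j φ)

/-- `φ ∈ C^∞(Ω̄)` and `φ = 0` on some neighbourhood of `Γ`. -/
def IsSmoothVanishingNear (Ω Γ : Set E3) (φ : E3 → ℝ) : Prop :=
  ContDiff ℝ ∞ φ ∧ ∃ U : Set E3, IsOpen U ∧ Γ ⊆ U ∧ ∀ x ∈ U ∩ Ω, φ x = 0

/-- `H¹_Γ(Ω)`: the closure in `H¹(Ω)` of the smooth functions vanishing near `Γ`. -/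
def H1Vanishing (Ω Γ : Set E3) : Set (H1Jet Ω) :=
  closure {J | ∃ φ, IsSmoothVanishingNear Ω Γ φ ∧ IsH1JetOf φ J}

/-- `H²_Γ(Ω)`: the closure in `H²(Ω)` of the smooth functions vanishing near `Γ`. -/
def H2Vanishing (Ω Γ : Set E3) : Set (H2Jet Ω) :=
  closure {J | ∃ φ, IsSmoothVanishingNear Ω Γ φ ∧ IsH2JetOf φ J}

/-- `H¹₀(Ω)`: the closure of `C_c^∞(Ω)` in `H¹(Ω)`. -/
def H1Zero (Ω : Set E3) : Set (H1Jet Ω) :=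
  closure {J | ∃ φ, IsTestFunction Ω φ ∧ IsH1JetOf φ J}

theorem integrable_mul_of_test {ψ : E3 → ℝ} (hc : Continuous ψ) (hs : HasCompactSupport ψ)
    (v : L2 Ω) : Integrable (fun x => v x * ψ x) (volume.restrict Ω) := by
  have h1 : MemLp (v : E3 → ℝ) 2 (volume.restrict Ω) := Lp.memLp v
  have h2 : MemLp ψ 2 (volume.restrict Ω) := (hc.memLp_of_hasCompactSupport hs)
  exact h1.integrable_mul h2

theorem integrable_mul_test {φ : E3 → ℝ} (h : IsTestFunction Ω φ) (v : L2 Ω) :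
    Integrable (fun x => v x * φ x) (volume.restrict Ω) :=
  integrable_mul_of_test h.1.continuous h.2.1 v

theorem integrable_mul_pderiv {φ : E3 → ℝ} (h : IsTestFunction Ω φ) (i : Fin 3) (v : L2 Ω) :
    Integrable (fun x => v x * pderiv i φ x) (volume.restrict Ω) := by
  refine integrable_mul_of_test ?_ ?_ v
  · exact (h.1.continuous_fderiv (by simp)).clm_apply continuous_const
  · exact h.2.1.fderiv_apply ℝ (EuclideanSpace.single i 1)

theorem integral_add_mul (v w : L2 Ω) {ψ : E3 → ℝ}
    (hv : Integrable (fun x => v x * ψ x) (volume.restrict Ω))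
    (hw : Integrable (fun x => w x * ψ x) (volume.restrict Ω)) :
    ∫ x in Ω, (v + w : L2 Ω) x * ψ x = (∫ x in Ω, v x * ψ x) + ∫ x in Ω, w x * ψ x := by
  rw [← integral_add hv hw]
  refine integral_congr_ae ?_
  filter_upwards [Lp.coeFn_add v w] with x hx
  rw [hx, Pi.add_apply, add_mul]

theorem integral_smul_mul (c : ℝ) (v : L2 Ω) (ψ : E3 → ℝ) :
    ∫ x in Ω, (c • v : L2 Ω) x * ψ x = c * ∫ x in Ω, v x * ψ x := by
  rw [← integral_const_mul]
  refine integral_congr_ae ?_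
  filter_upwards [Lp.coeFn_smul c v] with x hx
  rw [hx, Pi.smul_apply, smul_eq_mul, mul_assoc]

theorem IsWeakDeriv.add {i : Fin 3} {v g v' g' : L2 Ω} (h : IsWeakDeriv i v g)
    (h' : IsWeakDeriv i v' g') : IsWeakDeriv i (v + v') (g + g') := by
  intro φ hφ
  rw [integral_add_mul _ _ (integrable_mul_pderiv hφ i v) (integrable_mul_pderiv hφ i v'),
    integral_add_mul _ _ (integrable_mul_test hφ g) (integrable_mul_test hφ g'), h φ hφ, h' φ hφ]
  ring

theorem IsWeakDeriv.smul {i : Fin 3} {v g : L2 Ω} (c : ℝ) (h : IsWeakDeriv i v g) :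
    IsWeakDeriv i (c • v) (c • g) := by
  intro φ hφ
  rw [integral_smul_mul, integral_smul_mul, h φ hφ]
  ring

theorem isWeakDeriv_zero (i : Fin 3) : IsWeakDeriv i (0 : L2 Ω) 0 := by
  intro φ _
  have e (ψ : E3 → ℝ) : ∫ x in Ω, (0 : L2 Ω) x * ψ x = 0 := by
    simpa using integral_smul_mul 0 (0 : L2 Ω) ψ
  rw [e, e, neg_zero]

/-- The Sobolev space `H²(Ω)`: all weak derivatives of order at most two lie in `L²(Ω)`. -/
def H2 (Ω : Set E3) : Submodule ℝ (H2Jet Ω) where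
  carrier := {J | (∀ i, IsWeakDeriv i (val₂ J) (grad₂ J i)) ∧
    ∀ i j, IsWeakDeriv i (grad₂ J j) (hess₂ J i j)}
  add_mem' := fun h h' =>
    ⟨fun i => (h.1 i).add (h'.1 i), fun i j => (h.2 i j).add (h'.2 i j)⟩
  zero_mem' := ⟨fun i => isWeakDeriv_zero i, fun i _ => isWeakDeriv_zero i⟩
  smul_mem' := fun c _ h => ⟨fun i => (h.1 i).smul c, fun i j => (h.2 i j).smul c⟩

/-- The canonical map `L²(Ω) → (H²(Ω))*`, `w ↦ (φ ↦ (w, φ))`. -/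
def toH2Dual (w : L2 Ω) : StrongDual ℝ (H2 Ω) :=
  (innerSL ℝ w).comp ((PiLp.proj 2 (𝕜 := ℝ)
    (fun _ : Option (Fin 3 ⊕ Fin 3 × Fin 3) => L2 Ω) none).comp (H2 Ω).subtypeL)

theorem toH2Dual_apply (w : L2 Ω) (φ : H2 Ω) :
    toH2Dual w φ = ∫ x in Ω, w x * val₂ (φ : H2Jet Ω) x := by
  change inner ℝ w (val₂ (φ : H2Jet Ω)) = _
  rw [L2.inner_def]
  simp [mul_comm]

/-! ### Spaces of functions of time -/

/-- Lebesgue measure on `(0, T)`. -/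
def timeMeasure (T : ℝ) : Measure ℝ := volume.restrict (Ioo 0 T)

/-- `f ∈ H¹(0, T; X)` with `∂ₜ f = g`, where `X` is a closed subspace of `Y` and `f` is the
continuous representative. -/
structure IsH1InTime {Y : Type*} [NormedAddCommGroup Y] [NormedSpace ℝ Y] (T : ℝ) (X : Set Y)
    (f g : ℝ → Y) : Prop where
  memLp_deriv : MemLp g 2 (timeMeasure T)
  deriv_mem : ∀ᵐ t ∂(timeMeasure T), g t ∈ X
  mem : ∀ t ∈ Icc 0 T, f t ∈ X
  eq_integral : ∀ t ∈ Icc 0 T, f t = f 0 + ∫ s in (0 : ℝ)..t, g s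

/-- `θ ∈ L²(0, T; H^{-1/2}(Γ_G))`. Here `H^{-1/2}(Γ_G)` is the dual of the space of traces on `Γ_G`
of functions of `H¹_{Γ_A}(Ω)`, that is, of the quotient of `H¹_{Γ_A}(Ω)` by `H¹₀(Ω)`: a bounded
functional of `H¹` functions that vanishes on `H¹₀(Ω)`. The pairing `⟨θ, v⟩_{Γ_G}` is the value
of the functional at `v`. -/
structure IsGroundForce (Ω : Set E3) (T : ℝ) (θ : ℝ → StrongDual ℝ (H1Jet Ω)) : Prop where
  memLp : MemLp θ 2 (timeMeasure T)
  vanish : ∀ᵐ t ∂(timeMeasure T), ∀ J ∈ H1Zero Ω, θ t J = 0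

/-! ### The anisotropic system of the polluted atmosphere -/

/-- The data of the problem that do not depend on the aspect ratio: base and height of the domain,
final time, viscosities, diffusion matrix, rotation parameter, latitude, initial values of the
velocity and of the concentration, wind traction on the ground. -/
structure Data where
  G : Set E2
  d : E2 → ℝ
  T : ℝ
  ν : Fin 3 → ℝ
  M : Matrix (Fin 3) (Fin 3) ℝ
  f : ℝ
  lat : ℝ → ℝ
  u₀ : Fin 3 → L2 (domain G d)
  C₀ : L2 (domain G d)
  θ : Fin 2 → ℝ → StrongDual ℝ (H1Jet (domain G d))

namespace Data

/-- The domain `Ω`. -/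
abbrev dom (D : Data) : Set E3 := domain D.G D.d

/-- The standing assumptions on the data. -/
structure Admissible (D : Data) : Prop where
  lipschitz_base : IsLipschitzDomain D.G
  lipschitz_height : ∃ K : ℝ≥0, LipschitzOnWith K D.d (closure D.G)
  height_nonneg : ∀ x ∈ closure D.G, 0 ≤ D.d x
  time_pos : 0 < D.T
  visc_pos : ∀ i, 0 < D.ν i
  coercive : ∃ l : ℝ, 0 < l ∧
    ∀ ξ : Fin 3 → ℝ, l * ∑ i, ξ i ^ 2 ≤ ∑ i, ∑ j, D.M i j * ξ j * ξ i
  lat_measurable : Measurable D.lat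
  ground : ∀ j, IsGroundForce D.dom D.T (D.θ j)

/-- `α = 2 f sin(l(x₂))`. -/
def α (D : Data) (x : E3) : ℝ := 2 * D.f * Real.sin (D.lat (x 1))

/-- `β = 2 f cos(l(x₂))`. -/
def β (D : Data) (x : E3) : ℝ := 2 * D.f * Real.cos (D.lat (x 1))

/-- `H¹_{Γ_A}(Ω)`. -/
def H1A (D : Data) : Set (H1Jet D.dom) := H1Vanishing D.dom (aboveBdry D.G D.d)

/-- `H²_{Γ_A}(Ω)`. -/
def H2A (D : Data) : Set (H2Jet D.dom) := H2Vanishing D.dom (aboveBdry D.G D.d)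

/-- `V`: divergence free fields in `H¹_{Γ_A}(Ω) × H¹_{Γ_A}(Ω) × H¹₀(Ω)`. -/
def V (D : Data) : Set (Fin 3 → H1Jet D.dom) :=
  {v | v 0 ∈ D.H1A ∧ v 1 ∈ D.H1A ∧ v 2 ∈ H1Zero D.dom ∧ ∑ i, grad (v i) i = 0}

/-- `(∇_ν v, ∇_ν w)` for scalar functions. -/
def viscForm (D : Data) (v w : H1Jet D.dom) : ℝ := ∑ i, D.ν i * inner ℝ (grad v i) (grad w i)

/-- `(M p, q)` for `L²` vector fields. -/
def diffForm (D : Data) (p q : Fin 3 → L2 D.dom) : ℝ :=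
  ∑ i, ∑ j, D.M i j * inner ℝ (p j) (q i)

/-- `⟨θ_H, v_H⟩_{Γ_G}` at time `t`. -/
def groundPairing (D : Data) (t : ℝ) (v : Fin 3 → H1Jet D.dom) : ℝ :=
  ∑ j : Fin 2, D.θ j t (v j.castSucc)

/-- The weak form of the momentum equations for the velocity `u`, with test field `w` and
`w' = ∂ₜ w`. -/
def MomentumIdentity (D : Data) (ε : ℝ) (u w w' : ℝ → Fin 3 → H1Jet D.dom) : Prop :=
  (∫ t in (0 : ℝ)..D.T,
      (-(∑ j : Fin 2, inner ℝ (val (u t j.castSucc)) (val (w' t j.castSucc)))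
        + (∑ j : Fin 2, D.viscForm (u t j.castSucc) (w t j.castSucc))
        - (∫ x in D.dom, ∑ j : Fin 2, val (u t j.castSucc) x *
            ∑ i, val (u t i) x * grad (w t j.castSucc) i x)
        + ∫ x in D.dom, D.α x *
            (-(val (u t 1) x) * val (w t 0) x + val (u t 0) x * val (w t 1) x)))
    + ε * (∫ t in (0 : ℝ)..D.T,
        ((∫ x in D.dom, D.β x * val (u t 2) x * val (w t 0) x)
          - ∫ x in D.dom, D.β x * val (u t 0) x * val (w t 2) x))
    + ε ^ 2 * (∫ t in (0 : ℝ)..D.T,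
        (-(inner ℝ (val (u t 2)) (val (w' t 2)))
          + (∫ x in D.dom, (∑ i, val (u t i) x * grad (u t 2) i x) * val (w t 2) x)
          + D.viscForm (u t 2) (w t 2)))
    = (∑ j : Fin 2, inner ℝ (D.u₀ j.castSucc) (val (w 0 j.castSucc)))
      + ε ^ 2 * inner ℝ (D.u₀ 2) (val (w 0 2))
      - ∫ t in (0 : ℝ)..D.T, D.groundPairing t (w t)

/-- The weak form of the concentration equation, with test function `w` and `w' = ∂ₜ w`. -/
def ConcentrationIdentity (D : Data) (S : ℝ → L2 D.dom) (u : ℝ → Fin 3 → H1Jet D.dom)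
    (C : ℝ → H1Jet D.dom) (w w' : ℝ → H2Jet D.dom) : Prop :=
  (∫ t in (0 : ℝ)..D.T,
      (-(inner ℝ (val (C t)) (val₂ (w' t)))
        - (∫ x in D.dom, ∑ i, val (u t i) x * val (C t) x * grad₂ (w t) i x)
        + D.diffForm (grad (C t)) (grad₂ (w t))))
    = inner ℝ D.C₀ (val₂ (w 0)) + ∫ t in (0 : ℝ)..D.T, inner ℝ (S t) (val₂ (w t))

/-- `(u, C)` is a weak solution, for the aspect ratio `ε` and the source `S`, of the anisotropic
system. -/
structure IsWeakSolution (D : Data) (ε : ℝ) (S : ℝ → L2 D.dom)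
    (u : ℝ → Fin 3 → H1Jet D.dom) (C : ℝ → H1Jet D.dom) : Prop where
  velocity_memLp : MemLp u 2 (timeMeasure D.T)
  velocity_mem : ∀ᵐ t ∂(timeMeasure D.T), u t ∈ D.V
  velocity_bounded : ∀ i, MemLp (fun t => val (u t i)) ∞ (timeMeasure D.T)
  conc_memLp : MemLp C 2 (timeMeasure D.T)
  conc_mem : ∀ᵐ t ∂(timeMeasure D.T), C t ∈ D.H1A
  conc_bounded : MemLp (fun t => val (C t)) ∞ (timeMeasure D.T)
  momentum : ∀ w w' : ℝ → Fin 3 → H1Jet D.dom,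
    IsH1InTime D.T D.V w w' → w D.T = 0 → D.MomentumIdentity ε u w w'
  concentration : ∀ w w' : ℝ → H2Jet D.dom,
    IsH1InTime D.T D.H2A w w' → w D.T = 0 → D.ConcentrationIdentity S u C w w'

/-- The energy inequality, for almost every `t ∈ (0, T)`. -/
def EnergyInequality (D : Data) (ε : ℝ) (S : ℝ → L2 D.dom)
    (u : ℝ → Fin 3 → H1Jet D.dom) (C : ℝ → H1Jet D.dom) : Prop :=
  ∀ᵐ t ∂(timeMeasure D.T),
    1 / 2 * ((∑ j : Fin 2, ‖val (u t j.castSucc)‖ ^ 2) + ε ^ 2 * ‖val (u t 2)‖ ^ 2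
        + ‖val (C t)‖ ^ 2)
      + (∫ s in (0 : ℝ)..t,
          ((∑ j : Fin 2, D.viscForm (u s j.castSucc) (u s j.castSucc))
            + ε ^ 2 * D.viscForm (u s 2) (u s 2) + D.diffForm (grad (C s)) (grad (C s))))
    ≤ 1 / 2 * ((∑ j : Fin 2, ‖D.u₀ j.castSucc‖ ^ 2) + ε ^ 2 * ‖D.u₀ 2‖ ^ 2 + ‖D.C₀‖ ^ 2)
      + (∫ s in (0 : ℝ)..t, |D.groundPairing s (u s)|)
      + ∫ s in (0 : ℝ)..t, inner ℝ (S s) (val (C s))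

end Data

end PollutedAtmosphere

end

/-!
The estimate holds with `L²(Ω)` in place of the larger space `(H²(Ω))*`, and this is what is proved.

The equation controls an increment `w = C(t + h) - C(t)` only when it is tested against functions
vanishing near `Γ_A`. On the other hand `w` itself lies in `H¹_{Γ_A}(Ω)`, so it is close in `L²(Ω)`
to admissible test functions, and `‖w‖²` can be estimated by testing the equation against
regularizations of `w`.

* **Regularization** (`exists_regularization`). Functions of `H¹_{Γ_A}(Ω)`, extended by zero, are
  `H¹` in the whole upper half-space, hence Lipschitz in `L²` under translations that do not go
  downwards (`eLpNorm_translate_sub_le`). Since the base is Lipschitz and so is the height, near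
  `Γ_A` finitely many such translations of length of order `δ` lead out of `Ω`
  (`exists_exit_directions`). Therefore a function of `H¹_{Γ_A}(Ω)` is of order `δ` in `L²` of a
  `δ`-neighbourhood of `Γ_A`. Cutting it off there and mollifying at scale `δ`, with a kernel that
  only looks upwards, gives a smooth function vanishing near `Γ_A`, at `L²` distance of order `δ`,
  whose gradient is at most of order `δ^(-5/2)` times the `L²` norm.
* **Equation** (`exists_increment_bound`). Test functions `χ(t) φ(x)` give the increment tested
  against a smooth `φ`: it is at most `sup (|φ| + |∇φ|)` times the integral over `(t, t + h)` of a
  rate of order `‖u‖ ‖C‖ + ‖C‖_{H¹} + ‖S‖`. Because the gradient of the regularization is bounded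
  pointwise, no Sobolev embedding is needed here.
* **Energy** (`exists_rate_bound`). Poincaré's inequality in the vertical direction, again a
  translation estimate, and Young's inequality absorb the forcing in the dissipation. The vertical
  velocity, whose bound in the energy degenerates with `ε`, is recovered from `∂₃u₃ = -∂₁u₁ - ∂₂u₂`.
  So the rate is bounded in `L²(0, T)` uniformly in `ε`.

Together, `‖w‖ ≤ c δ ‖w‖_{H¹} + c δ^(-5/2) ∫ rate` (`exists_norm_increment_le`); in `L²(0, T - h)`
the right-hand side is of order `δ + δ^(-5/2) h`, and `δ` of order `h^(1/4)` gives the claim.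
-/

namespace PollutedAtmosphere

/-! ### The geometry of the domain -/

theorem continuous_horiz : Continuous horiz := by
  unfold horiz
  fun_prop

theorem norm_horiz_le (p : E3) : ‖horiz p‖ ≤ ‖p‖ := by
  rw [EuclideanSpace.norm_eq, EuclideanSpace.norm_eq]
  apply Real.sqrt_le_sqrt
  simp only [horiz, Fin.sum_univ_two, Fin.sum_univ_three]
  simp
  positivity

theorem horiz_add (p q : E3) : horiz (p + q) = horiz p + horiz q := by
  ext i; fin_cases i <;> simp [horiz]

theorem horiz_sub (p q : E3) : horiz (p - q) = horiz p - horiz q := by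
  ext i; fin_cases i <;> simp [horiz]

theorem horiz_smul (c : ℝ) (p : E3) : horiz (c • p) = c • horiz p := by
  ext i; fin_cases i <;> simp [horiz]

theorem dist_horiz_le (p q : E3) : dist (horiz p) (horiz q) ≤ dist p q := by
  rw [dist_eq_norm, dist_eq_norm, ← horiz_sub]
  exact norm_horiz_le _

theorem abs_coord_le {n : ℕ} (p : EuclideanSpace ℝ (Fin n)) (i : Fin n) : |p i| ≤ ‖p‖ := by
  simpa using PiLp.norm_apply_le p i

theorem abs_coord_sub_le_dist {n : ℕ} (p q : EuclideanSpace ℝ (Fin n)) (i : Fin n) :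
    |p i - q i| ≤ dist p q := by
  simpa [dist_eq_norm] using abs_coord_le (p - q) i

theorem eventually_notMem_of_notMem_closure {s : Set E3} {x : E3} (hx : x ∉ closure s) :
    ∀ᶠ y in 𝓝 x, y ∉ s := by
  filter_upwards [isClosed_closure.isOpen_compl.mem_nhds hx] with y hy h
  exact hy (subset_closure h)

/-- The vector `(a₁, a₂, 0)`. -/
noncomputable def horizLift (a : E2) : E3 := !₂[a 0, a 1, 0]

@[simp] theorem horiz_horizLift (a : E2) : horiz (horizLift a) = a := by
  ext i; fin_cases i <;> simp [horiz, horizLift]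

@[simp] theorem horizLift_two (a : E2) : horizLift a 2 = 0 := by
  simp [horizLift]

/-- The vertical unit vector. -/
noncomputable def vert : E3 := EuclideanSpace.single 2 1

@[simp] theorem vert_two : vert 2 = 1 := by simp [vert]

@[simp] theorem horiz_vert : horiz vert = 0 := by
  ext i; fin_cases i <;> simp [horiz, vert]

section Domain

variable {G : Set E2} {d : E2 → ℝ}

theorem isOpen_domain (hG : IsOpen G) (hd : ContinuousOn d (closure G)) :
    IsOpen (domain G d) := by
  have h1 : IsOpen (horiz ⁻¹' G) := hG.preimage continuous_horiz
  have h2 : ContinuousOn (fun p : E3 => d (horiz p) - p 2) (horiz ⁻¹' G) := by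
    refine ContinuousOn.sub ?_ (by fun_prop)
    exact (hd.mono subset_closure).comp continuous_horiz.continuousOn fun x hx => hx
  have h3 := h2.isOpen_inter_preimage h1 (isOpen_Ioi (a := (0 : ℝ)))
  have h4 : IsOpen {p : E3 | 0 < p 2} := isOpen_lt continuous_const (by fun_prop)
  convert h3.inter h4 using 1
  ext p
  simp only [domain, mem_ofPred_eq, mem_inter_iff, mem_preimage, mem_Ioi, sub_pos]
  tauto

/-- Above the ground, the boundary of the domain is contained in `Γ_A`. -/
theorem mem_aboveBdry_of_mem_closure (hG : IsOpen G) (hd : ContinuousOn d (closure G))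
    {x : E3} (hx : x ∈ closure (domain G d)) (hx' : x ∉ domain G d) (h2 : 0 < x 2) :
    x ∈ aboveBdry G d := by
  have hc : horiz x ∈ closure G :=
    map_mem_closure continuous_horiz hx fun y hy => hy.1
  have hle : x 2 ≤ d (horiz x) := by
    have hcont : ContinuousWithinAt (fun p : E3 => d (horiz p) - p 2) (domain G d) x := by
      refine ContinuousWithinAt.sub ?_ (by fun_prop)
      exact ContinuousWithinAt.comp (t := closure G) (hd _ hc)
        continuous_horiz.continuousWithinAt fun y hy => subset_closure hy.1
    have : d (horiz x) - x 2 ∈ closure (Ici (0 : ℝ)) :=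
      hcont.mem_closure hx fun y hy => sub_nonneg.2 hy.2.2.le
    simpa [closure_Ici] using this
  by_cases hxG : horiz x ∈ G
  · left
    refine ⟨hxG, le_antisymm hle ?_⟩
    by_contra! hlt
    exact hx' ⟨hxG, h2, hlt⟩
  · right
    exact ⟨⟨hc, by rwa [hG.interior_eq]⟩, h2.le, hle⟩

theorem disjoint_domain_aboveBdry (hG : IsOpen G) : Disjoint (domain G d) (aboveBdry G d) := by
  rw [Set.disjoint_left]
  rintro x ⟨h1, h2, h3⟩ (h | h)
  · exact h3.ne h.2
  · have := h.1.2
    rw [hG.interior_eq] at this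
    exact this h1

theorem exists_height_bound (hG : Bornology.IsBounded G) (hd : ContinuousOn d (closure G)) :
    ∃ L : ℝ, 0 < L ∧ ∀ x ∈ closure G, d x ≤ L := by
  have hcpt : IsCompact (closure G) := hG.isCompact_closure
  obtain ⟨L, hL⟩ := (hcpt.image_of_continuousOn hd).bddAbove
  exact ⟨max L 1, by positivity, fun x hx => le_max_of_le_left (hL ⟨x, hx, rfl⟩)⟩

theorem isBounded_domain (hG : Bornology.IsBounded G) (hd : ContinuousOn d (closure G)) :
    Bornology.IsBounded (domain G d) := by
  obtain ⟨L, hL, hLd⟩ := exists_height_bound hG hd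
  obtain ⟨R, hR⟩ := hG.exists_norm_le
  rw [isBounded_iff_forall_norm_le]
  refine ⟨Real.sqrt (R ^ 2 + L ^ 2), fun p hp => ?_⟩
  rw [EuclideanSpace.norm_eq]
  apply Real.sqrt_le_sqrt
  have h1 := hR _ hp.1
  have h0 : ‖horiz p‖ ^ 2 = p 0 ^ 2 + p 1 ^ 2 := by
    rw [EuclideanSpace.norm_sq_eq]
    simp [horiz, Fin.sum_univ_two]
  have h2 : ‖horiz p‖ ^ 2 ≤ R ^ 2 := by gcongr
  have h3 : p 2 ^ 2 ≤ L ^ 2 := by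
    have := hp.2.1
    have h4 := hp.2.2.trans_le (hLd _ (subset_closure hp.1))
    gcongr
  simp only [Fin.sum_univ_three, Real.norm_eq_abs, sq_abs]
  linarith

/-- Near the boundary of a bounded Lipschitz domain of the plane, one leaves the domain by a step
of length comparable to the distance to the boundary, in one of finitely many directions. -/
theorem exists_exit_directions_base (hG : IsLipschitzDomain G) :
    ∃ (A : Set E2) (δ₀ : ℝ), A.Finite ∧ 0 < δ₀ ∧ ∀ δ, 0 < δ → δ ≤ δ₀ → ∀ y ∈ frontier G, ∀ q,
      dist q y < 2 * δ → ∃ a ∈ A, q + δ • a ∉ G := by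
  have hcpt : IsCompact (frontier G) :=
    hG.isBounded.isCompact_closure.of_isClosed_subset isClosed_frontier frontier_subset_closure
  refine hcpt.induction_on (p := fun s => ∃ (A : Set E2) (δ₀ : ℝ), A.Finite ∧ 0 < δ₀ ∧
    ∀ δ, 0 < δ → δ ≤ δ₀ → ∀ y ∈ s, ∀ q, dist q y < 2 * δ → ∃ a ∈ A, q + δ • a ∉ G) ?_ ?_ ?_ ?_
  · exact ⟨∅, 1, finite_empty, one_pos, by simp⟩
  · rintro s t hst ⟨A, δ₀, hA, h0, h⟩
    exact ⟨A, δ₀, hA, h0, fun δ hδ hδ' y hy => h δ hδ hδ' y (hst hy)⟩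
  · rintro s t ⟨A, δ₀, hA, h0, h⟩ ⟨A', δ₀', hA', h0', h'⟩
    refine ⟨A ∪ A', min δ₀ δ₀', hA.union hA', lt_min h0 h0', fun δ hδ hδ' y hy q hq => ?_⟩
    rcases hy with hy | hy
    · obtain ⟨a, ha, hq⟩ := h δ hδ (hδ'.trans (min_le_left _ _)) y hy q hq
      exact ⟨a, Or.inl ha, hq⟩
    · obtain ⟨a, ha, hq⟩ := h' δ hδ (hδ'.trans (min_le_right _ _)) y hy q hq
      exact ⟨a, Or.inr ha, hq⟩
  · intro p hp
    obtain ⟨e, γ, K, U, hγ, hU, hpU, hGU⟩ := hG.localGraph p hp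
    obtain ⟨r, hr, hrU⟩ := Metric.isOpen_iff.1 hU p hpU
    -- Downwards in the chart: the graph is at most `2 (1 + K) δ` below a point at distance
    -- less than `2 δ` from the boundary.
    set a : E2 := e.linearIsometryEquiv.symm ((-(2 * (1 + K)) : ℝ) • EuclideanSpace.single 1 1)
      with ha
    have hea (q : E2) (δ : ℝ) :
        e (q + δ • a) = e q + (-(2 * (1 + K) * δ)) • EuclideanSpace.single 1 1 := by
      have h1 := e.map_vadd q (δ • a)
      rw [vadd_eq_add, vadd_eq_add, add_comm, add_comm _ (e q)] at h1
      rw [h1, map_smul, ha, LinearIsometryEquiv.apply_symm_apply, smul_smul]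
      congr 2
      ring
    refine ⟨Metric.ball p (r / 2) ∩ frontier G,
      inter_comm _ _ ▸ inter_mem_nhdsWithin _ (Metric.ball_mem_nhds _ (half_pos hr)), {a},
      r / 2 / (2 + ‖a‖), finite_singleton a, by positivity, ?_⟩
    rintro δ hδ hδ' y ⟨hyp, hy⟩ q hq
    refine ⟨a, rfl, fun hmem => ?_⟩
    have hδr : δ * (2 + ‖a‖) ≤ r / 2 := (le_div_iff₀ (by positivity)).1 hδ'
    have hyp' := Metric.mem_ball.1 hyp
    have hyU : y ∈ U := hrU (Metric.mem_ball.2 (by linarith))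
    have hqU : q + δ • a ∈ U := by
      refine hrU (Metric.mem_ball.2 ?_)
      calc dist (q + δ • a) p ≤ dist (q + δ • a) q + (dist q y + dist y p) :=
            (dist_triangle _ _ _).trans (by gcongr; exact dist_triangle _ _ _)
        _ < δ * ‖a‖ + (2 * δ + r / 2) := by
            rw [dist_self_add_left, norm_smul, Real.norm_of_nonneg hδ.le]
            gcongr
        _ ≤ r := by linarith
    have h1 := (hGU _ hqU).1 hmem
    have h2 : e y 1 ≤ γ (e y 0) := by
      by_contra! hlt
      have := hy.2
      rw [hG.isOpen.interior_eq] at this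
      exact this ((hGU y hyU).2 hlt)
    have h3 := abs_coord_sub_le_dist (e q) (e y) 1
    have h4 := abs_coord_sub_le_dist (e q) (e y) 0
    rw [e.dist_map] at h3 h4
    have h5 : |γ (e q 0) - γ (e y 0)| ≤ K * |e q 0 - e y 0| := by
      simpa [Real.dist_eq] using hγ.dist_le_mul (e q 0) (e y 0)
    have h6 : (K : ℝ) * |e q 0 - e y 0| ≤ K * (2 * δ) := by
      gcongr
      exact h4.trans hq.le
    rw [hea] at h1
    simp at h1
    have := abs_le.1 h5
    have := abs_le.1 h3
    linarith

/-- Near `Γ_A`, one leaves the domain, without approaching the ground, by a step of length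
comparable to the distance to `Γ_A`, in one of finitely many directions. -/
theorem exists_exit_directions (hG : IsLipschitzDomain G) {K : ℝ≥0}
    (hd : LipschitzOnWith K d (closure G)) :
    ∃ (A : Finset E3) (δ₀ : ℝ), (∀ a ∈ A, 0 ≤ a 2) ∧ 0 < δ₀ ∧ ∀ δ, 0 < δ → δ ≤ δ₀ →
      ∀ x ∈ domain G d, ∀ y ∈ aboveBdry G d, dist x y < 2 * δ →
        ∃ a ∈ A, x + δ • a ∉ domain G d := by
  classical
  obtain ⟨A, δ₀, hA, h0, h⟩ := exists_exit_directions_base hG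
  refine ⟨insert ((2 * (1 + K) : ℝ) • vert) (hA.toFinset.image horizLift), δ₀, ?_, h0, ?_⟩
  · intro a ha
    rcases Finset.mem_insert.1 ha with rfl | ha
    · simp; positivity
    · obtain ⟨b, -, rfl⟩ := Finset.mem_image.1 ha
      simp
  rintro δ hδ hδ' x hx y (hy | hy) hxy
  · refine ⟨_, Finset.mem_insert_self _ _, fun hmem => ?_⟩
    have h1 := hmem.2.2
    rw [horiz_add, horiz_smul, horiz_smul, horiz_vert, smul_zero, smul_zero, add_zero] at h1
    simp at h1
    have h2 := hd.dist_le_mul _ (subset_closure hx.1) _ (subset_closure hy.1)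
    have h3 : (K : ℝ) * dist (horiz x) (horiz y) ≤ K * (2 * δ) := by
      gcongr
      exact (dist_horiz_le x y).trans hxy.le
    rw [Real.dist_eq] at h2
    have h4 := abs_le.1 (abs_coord_sub_le_dist x y 2)
    have h5 := abs_le.1 h2
    have := hy.2
    linarith
  · obtain ⟨a, ha, hn⟩ := h δ hδ hδ' _ hy.1 (horiz x) ((dist_horiz_le x y).trans_lt hxy)
    refine ⟨horizLift a, Finset.mem_insert_of_mem
      (Finset.mem_image_of_mem _ (hA.mem_toFinset.2 ha)), fun hmem => hn ?_⟩
    have := hmem.1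
    rwa [horiz_add, horiz_smul, horiz_horizLift] at this

end Domain

/-! ### Square integrals -/

theorem eLpNorm_two_sq {α F : Type*} [MeasurableSpace α] [NormedAddCommGroup F] (μ : Measure α)
    (f : α → F) : eLpNorm f 2 μ ^ 2 = ∫⁻ x, ‖f x‖ₑ ^ 2 ∂μ := by
  have := eLpNorm_nnreal_pow_eq_lintegral (f := f) (μ := μ) (p := 2) two_ne_zero
  simpa using this

theorem eLpNorm_two_le_iff {α F : Type*} [MeasurableSpace α] [NormedAddCommGroup F]
    {μ : Measure α} {f : α → F} {c : ℝ≥0∞} :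
    eLpNorm f 2 μ ≤ c ↔ ∫⁻ x, ‖f x‖ₑ ^ 2 ∂μ ≤ c ^ 2 := by
  rw [← eLpNorm_two_sq, ENNReal.pow_le_pow_left_iff two_ne_zero]

theorem sq_lintegral_mul_le {α : Type*} [MeasurableSpace α] {μ : Measure α} {f g : α → ℝ≥0∞}
    (hf : AEMeasurable f μ) (hg : AEMeasurable g μ) :
    (∫⁻ x, f x * g x ∂μ) ^ 2 ≤ (∫⁻ x, f x ^ 2 ∂μ) * ∫⁻ x, g x ^ 2 ∂μ := by
  have h := ENNReal.lintegral_mul_le_Lp_mul_Lq μ Real.HolderConjugate.two_two hf hg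
  have h2 := pow_le_pow_left' h 2
  rw [mul_pow, ← ENNReal.rpow_mul_natCast, ← ENNReal.rpow_mul_natCast] at h2
  simpa using h2

theorem sq_lintegral_le {α : Type*} [MeasurableSpace α] {μ : Measure α} {f : α → ℝ≥0∞}
    (hf : AEMeasurable f μ) : (∫⁻ x, f x ∂μ) ^ 2 ≤ μ univ * ∫⁻ x, f x ^ 2 ∂μ := by
  simpa [mul_comm] using sq_lintegral_mul_le hf (aemeasurable_const (b := 1))

/-! ### Extension by zero and translations -/

/-- The open upper half-space `x₃ > 0`. -/
def upperHalf : Set E3 := {x | 0 < x 2}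

theorem measurableSet_upperHalf : MeasurableSet upperHalf :=
  (isOpen_lt continuous_const (by fun_prop)).measurableSet

theorem add_mem_upperHalf {x v : E3} (hx : x ∈ upperHalf) (hv : 0 ≤ v 2) : x + v ∈ upperHalf := by
  have : 0 < x 2 := hx
  change 0 < (x + v) 2
  simp
  linarith

theorem lintegral_upperHalf_comp_add_le (f : E3 → ℝ≥0∞) {v : E3} (hv : 0 ≤ v 2) :
    ∫⁻ x in upperHalf, f (x + v) ≤ ∫⁻ x in upperHalf, f x := by
  rw [← lintegral_indicator measurableSet_upperHalf, ← lintegral_indicator measurableSet_upperHalf,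
    ← lintegral_add_right_eq_self (upperHalf.indicator f) v]
  refine lintegral_mono fun x => ?_
  by_cases hx : x ∈ upperHalf
  · simp [hx, add_mem_upperHalf hx hv]
  · simp [hx]

section Extension

variable {Ω Γ : Set E3} {φ : E3 → ℝ}

/-- `Γ` contains the part of the boundary of `Ω` that lies above the ground. -/
def CoversUpperBdry (Ω Γ : Set E3) : Prop :=
  ∀ x ∈ closure Ω, x ∉ Ω → 0 < x 2 → x ∈ Γ

theorem IsSmoothVanishingNear.indicator_eventuallyEq (hΩ : IsOpen Ω) (hΓ : CoversUpperBdry Ω Γ)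
    (hφ : IsSmoothVanishingNear Ω Γ φ) {x : E3} (hx : x ∈ upperHalf) :
    (x ∈ Ω ∧ Ω.indicator φ =ᶠ[𝓝 x] φ) ∨ (x ∉ Ω ∧ Ω.indicator φ =ᶠ[𝓝 x] 0) := by
  by_cases hxΩ : x ∈ Ω
  · exact Or.inl ⟨hxΩ, by
      filter_upwards [hΩ.mem_nhds hxΩ] with y hy
      simp [hy]⟩
  refine Or.inr ⟨hxΩ, ?_⟩
  by_cases hxc : x ∈ closure Ω
  · obtain ⟨U, hU, hΓU, h0⟩ := hφ.2
    filter_upwards [hU.mem_nhds (hΓU (hΓ x hxc hxΩ hx))] with y hy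
    by_cases hyΩ : y ∈ Ω
    · simp [hyΩ, h0 y ⟨hy, hyΩ⟩]
    · simp [hyΩ]
  · filter_upwards [eventually_notMem_of_notMem_closure hxc] with y hy
    simp [hy]

theorem IsSmoothVanishingNear.contDiffAt_indicator (hΩ : IsOpen Ω) (hΓ : CoversUpperBdry Ω Γ)
    (hφ : IsSmoothVanishingNear Ω Γ φ) {x : E3} (hx : x ∈ upperHalf) :
    ContDiffAt ℝ 1 (Ω.indicator φ) x := by
  rcases hφ.indicator_eventuallyEq hΩ hΓ hx with ⟨-, h⟩ | ⟨-, h⟩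
  · exact (hφ.1.contDiffAt.of_le (by simp)).congr_of_eventuallyEq h
  · exact (contDiff_const (c := (0 : ℝ))).contDiffAt.congr_of_eventuallyEq h

theorem IsSmoothVanishingNear.fderiv_indicator (hΩ : IsOpen Ω) (hΓ : CoversUpperBdry Ω Γ)
    (hφ : IsSmoothVanishingNear Ω Γ φ) {x : E3} (hx : x ∈ upperHalf) :
    fderiv ℝ (Ω.indicator φ) x = Ω.indicator (fderiv ℝ φ) x := by
  rcases hφ.indicator_eventuallyEq hΩ hΓ hx with ⟨h', h⟩ | ⟨h', h⟩
  · rw [h.fderiv_eq, indicator_of_mem h']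
  · rw [h.fderiv_eq, indicator_of_notMem h']
    exact fderiv_const_apply 0

/-- The fundamental theorem of calculus along an upward segment, for a smooth function that
vanishes near `Γ`, extended by zero. -/
theorem IsSmoothVanishingNear.enorm_indicator_sub_le (hΩ : IsOpen Ω) (hΓ : CoversUpperBdry Ω Γ)
    (hφ : IsSmoothVanishingNear Ω Γ φ) {x v : E3} (hx : x ∈ upperHalf) (hv : 0 ≤ v 2) :
    ‖Ω.indicator φ (x + v) - Ω.indicator φ x‖ₑ ≤
      ∫⁻ s in Ioc (0 : ℝ) 1, ‖Ω.indicator (fun y => fderiv ℝ φ y v) (x + s • v)‖ₑ := by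
  have hmem (s : ℝ) (hs : 0 ≤ s) : x + s • v ∈ upperHalf :=
    add_mem_upperHalf hx (by simpa using mul_nonneg hs hv)
  have hγ (s : ℝ) : HasDerivAt (fun s : ℝ => x + s • v) v s := by
    simpa using ((hasDerivAt_id s).smul_const v).const_add x
  have hderiv : ∀ s ∈ uIcc (0 : ℝ) 1, HasDerivAt (fun s : ℝ => Ω.indicator φ (x + s • v))
      (fderiv ℝ (Ω.indicator φ) (x + s • v) v) s := by
    intro s hs
    rw [uIcc_of_le zero_le_one] at hs
    have := (hφ.contDiffAt_indicator hΩ hΓ (hmem s hs.1)).differentiableAt one_ne_zero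
    exact this.hasFDerivAt.comp_hasDerivAt s (hγ s)
  have hcont : ContinuousOn (fun s : ℝ => fderiv ℝ (Ω.indicator φ) (x + s • v) v)
      (uIcc (0 : ℝ) 1) := by
    intro s hs
    rw [uIcc_of_le zero_le_one] at hs
    have h1 := (hφ.contDiffAt_indicator hΩ hΓ (hmem s hs.1)).continuousAt_fderiv one_ne_zero
    have h2 : ContinuousAt (fun s : ℝ => x + s • v) s := (hγ s).continuousAt
    exact ((h1.comp (f := fun s : ℝ => x + s • v) h2).clm_apply
      continuousAt_const).continuousWithinAt
  have h := intervalIntegral.integral_eq_sub_of_hasDerivAt hderiv hcont.intervalIntegrable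
  simp only [one_smul, zero_smul, add_zero] at h
  rw [← h, intervalIntegral.integral_of_le zero_le_one]
  refine (enorm_integral_le_lintegral_enorm _).trans (le_of_eq ?_)
  refine setLIntegral_congr_fun measurableSet_Ioc fun s hs => ?_
  simp only [hφ.fderiv_indicator hΩ hΓ (hmem s hs.1.le)]
  by_cases hy : x + s • v ∈ Ω <;> simp [hy]

theorem IsSmoothVanishingNear.eLpNorm_translate_sub_le (hΩ : IsOpen Ω) (hΓ : CoversUpperBdry Ω Γ)
    (hφ : IsSmoothVanishingNear Ω Γ φ) {v : E3} (hv : 0 ≤ v 2) :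
    eLpNorm (fun x => Ω.indicator φ (x + v) - Ω.indicator φ x) 2 (volume.restrict upperHalf) ≤
      eLpNorm (fun x => fderiv ℝ φ x v) 2 (volume.restrict Ω) := by
  set D : E3 → ℝ := Ω.indicator (fun y => fderiv ℝ φ y v) with hD
  have hDm : Measurable D :=
    (((hφ.1.continuous_fderiv (by simp)).clm_apply continuous_const).measurable).indicator
      hΩ.measurableSet
  have hm2 : Measurable (fun p : E3 × ℝ => ‖D (p.1 + p.2 • v)‖ₑ ^ 2) := by
    have : Measurable (fun p : E3 × ℝ => p.1 + p.2 • v) := by fun_prop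
    exact ((hDm.comp this).enorm).pow_const 2
  rw [eLpNorm_two_le_iff, eLpNorm_two_sq]
  calc ∫⁻ x in upperHalf, ‖Ω.indicator φ (x + v) - Ω.indicator φ x‖ₑ ^ 2
      ≤ ∫⁻ x in upperHalf, ∫⁻ s in Ioc (0 : ℝ) 1, ‖D (x + s • v)‖ₑ ^ 2 := by
        refine setLIntegral_mono' measurableSet_upperHalf fun x hx => ?_
        refine (pow_le_pow_left' (hφ.enorm_indicator_sub_le hΩ hΓ hx hv) 2).trans ?_
        refine (sq_lintegral_le ?_).trans (by simp [hD])
        have : Measurable (fun s : ℝ => x + s • v) := by fun_prop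
        exact (hDm.comp this).enorm.aemeasurable
    _ = ∫⁻ s in Ioc (0 : ℝ) 1, ∫⁻ x in upperHalf, ‖D (x + s • v)‖ₑ ^ 2 :=
        lintegral_lintegral_swap hm2.aemeasurable
    _ ≤ ∫⁻ s in Ioc (0 : ℝ) 1, ∫⁻ x in upperHalf, ‖D x‖ₑ ^ 2 := by
        refine setLIntegral_mono' measurableSet_Ioc fun s hs => ?_
        exact lintegral_upperHalf_comp_add_le (fun x => ‖D x‖ₑ ^ 2)
          (by simpa using mul_nonneg hs.1.le hv)
    _ = ∫⁻ x in upperHalf, ‖D x‖ₑ ^ 2 := by simp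
    _ ≤ ∫⁻ x, ‖D x‖ₑ ^ 2 := setLIntegral_le_lintegral _ _
    _ = ∫⁻ x in Ω, ‖fderiv ℝ φ x v‖ₑ ^ 2 := by
        rw [← lintegral_indicator hΩ.measurableSet]
        refine lintegral_congr fun x => ?_
        by_cases hx : x ∈ Ω <;> simp [hD, hx]

/-- The derivative of a jet in the direction `v`. -/
noncomputable def dirGrad (v : E3) (J : H1Jet Ω) : L2 Ω := ∑ i, v i • grad J i

theorem norm_grad_le (J : H1Jet Ω) (i : Fin 3) : ‖grad J i‖ ≤ ‖J‖ := PiLp.norm_apply_le J (some i)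

theorem norm_val_le (J : H1Jet Ω) : ‖val J‖ ≤ ‖J‖ := PiLp.norm_apply_le J none

theorem val_sub (J J' : H1Jet Ω) : val (J - J') = val J - val J' := rfl

theorem grad_sub (J J' : H1Jet Ω) (i : Fin 3) : grad (J - J') i = grad J i - grad J' i := rfl

theorem dirGrad_sub (v : E3) (J J' : H1Jet Ω) :
    dirGrad v (J - J') = dirGrad v J - dirGrad v J' := by
  simp [dirGrad, grad_sub, smul_sub, Finset.sum_sub_distrib]

theorem norm_dirGrad_le (v : E3) (J : H1Jet Ω) : ‖dirGrad v J‖ ≤ 3 * ‖v‖ * ‖J‖ := by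
  refine (norm_sum_le _ _).trans ?_
  calc ∑ i, ‖v i • grad J i‖ ≤ ∑ _i : Fin 3, ‖v‖ * ‖J‖ := by
        refine Finset.sum_le_sum fun i _ => ?_
        rw [norm_smul]
        exact mul_le_mul (abs_coord_le v i) (norm_grad_le J i) (norm_nonneg _) (norm_nonneg _)
    _ = _ := by simp; ring

theorem dirGrad_ae_eq {J : H1Jet Ω} (hJ : IsH1JetOf φ J) (v : E3) :
    dirGrad v J =ᵐ[volume.restrict Ω] fun x => fderiv ℝ φ x v := by
  have h1 : dirGrad v J =ᵐ[volume.restrict Ω] ∑ i, ⇑(v i • grad J i) :=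
    Lp.coeFn_finsetSum _ _
  have h2 : ∀ᵐ x ∂(volume.restrict Ω), ∀ i, (v i • grad J i : L2 Ω) x = v i * pderiv i φ x := by
    rw [ae_all_iff]
    intro i
    filter_upwards [Lp.coeFn_smul (v i) (grad J i), hJ.2 i] with x h3 h4
    rw [h3, Pi.smul_apply, h4, smul_eq_mul]
  filter_upwards [h1, h2] with x h3 h4
  have hv : v = ∑ i, v i • EuclideanSpace.single i (1 : ℝ) := by
    ext j
    fin_cases j <;> simp [Fin.sum_univ_three]
  rw [h3, Finset.sum_apply]
  conv_rhs => rw [hv, map_sum]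
  refine Finset.sum_congr rfl fun i _ => ?_
  rw [h4 i, map_smul, smul_eq_mul, pderiv]

theorem indicator_ae_congr (hΩ : MeasurableSet Ω) {f g : E3 → ℝ}
    (h : f =ᵐ[volume.restrict Ω] g) : Ω.indicator f =ᵐ[volume] Ω.indicator g :=
  (ae_eq_restrict_iff_indicator_ae_eq hΩ).1 h

theorem eLpNorm_indicator_val (hΩ : MeasurableSet Ω) (w : L2 Ω) :
    eLpNorm (Ω.indicator w) 2 volume = ENNReal.ofReal ‖w‖ := by
  rw [eLpNorm_indicator_eq_eLpNorm_restrict hΩ, Lp.norm_def,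
    ENNReal.ofReal_toReal (Lp.eLpNorm_ne_top w)]

theorem aestronglyMeasurable_indicator_val (hΩ : MeasurableSet Ω) (w : L2 Ω) :
    AEStronglyMeasurable (Ω.indicator w) volume :=
  (aestronglyMeasurable_indicator_iff hΩ).2 (Lp.aestronglyMeasurable w)

theorem eLpNorm_translate_indicator (hΩ : MeasurableSet Ω) (w : L2 Ω) (v : E3) :
    eLpNorm (fun x => Ω.indicator w (x + v)) 2 volume = ENNReal.ofReal ‖w‖ := by
  rw [← eLpNorm_indicator_val hΩ w]
  exact eLpNorm_comp_measurePreserving (g := Ω.indicator w)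
    (aestronglyMeasurable_indicator_val hΩ w) (measurePreserving_add_right volume v)

/-- Translations of functions of `H¹_Γ(Ω)`, extended by zero, are controlled by their gradient as
long as they do not bring in the ground. -/
theorem eLpNorm_translate_sub_le (hΩ : IsOpen Ω) (hΓ : CoversUpperBdry Ω Γ) {v : E3}
    (hv : 0 ≤ v 2) {J : H1Jet Ω} (hJ : J ∈ H1Vanishing Ω Γ) :
    eLpNorm (fun x => Ω.indicator (val J) (x + v) - Ω.indicator (val J) x) 2
      (volume.restrict upperHalf) ≤ ENNReal.ofReal ‖dirGrad v J‖ := by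
  have hΩm := hΩ.measurableSet
  refine ENNReal.le_of_forall_pos_le_add fun ε hε _ => ?_
  -- It suffices to compare with a smooth jet at distance less than `η`.
  set η : ℝ := ε / (2 + 3 * ‖v‖) with hη
  obtain ⟨J', ⟨φ, hφ, hJ'⟩, hdist⟩ := Metric.mem_closure_iff.1 hJ η (by positivity)
  have hm := aestronglyMeasurable_indicator_val hΩm
  have hmt (w : L2 Ω) : AEStronglyMeasurable (fun x => Ω.indicator w (x + v)) volume :=
    (hm w).comp_quasiMeasurePreserving (measurePreserving_add_right volume v).quasiMeasurePreserving
  have hsub : Ω.indicator (val J) =ᵐ[volume]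
      fun x => Ω.indicator (val (J - J')) x + Ω.indicator φ x := by
    have h1 : (val J : E3 → ℝ) =ᵐ[volume.restrict Ω] fun x => val (J - J') x + φ x := by
      filter_upwards [Lp.coeFn_sub (val J) (val J'), hJ'.1] with x h1 h2
      rw [val_sub, h1, Pi.sub_apply, h2, sub_add_cancel]
    refine (indicator_ae_congr hΩm h1).trans (Eventually.of_forall fun x => ?_)
    by_cases hx : x ∈ Ω <;> simp [hx]
  have hsubt := (measurePreserving_add_right volume v).quasiMeasurePreserving.ae_eq_comp hsub
  have hφm : AEStronglyMeasurable (Ω.indicator φ) volume :=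
    (hφ.1.continuous.aestronglyMeasurable).indicator hΩm
  have hφmt : AEStronglyMeasurable (fun x => Ω.indicator φ (x + v)) volume :=
    hφm.comp_quasiMeasurePreserving (measurePreserving_add_right volume v).quasiMeasurePreserving
  calc eLpNorm (fun x => Ω.indicator (val J) (x + v) - Ω.indicator (val J) x) 2
        (volume.restrict upperHalf)
      = eLpNorm ((fun x => Ω.indicator (val (J - J')) (x + v) - Ω.indicator (val (J - J')) x) +
          fun x => Ω.indicator φ (x + v) - Ω.indicator φ x) 2 (volume.restrict upperHalf) := by
        refine eLpNorm_congr_ae (ae_restrict_of_ae ?_)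
        filter_upwards [hsub, hsubt] with x h1 h2
        simp only [Function.comp_apply] at h2
        simp only [Pi.add_apply]
        rw [h1, h2]
        ring
    _ ≤ (ENNReal.ofReal ‖val (J - J')‖ + ENNReal.ofReal ‖val (J - J')‖) +
          eLpNorm (fun x => fderiv ℝ φ x v) 2 (volume.restrict Ω) := by
        refine (eLpNorm_add_le ((hmt _).sub (hm _)).restrict (hφmt.sub hφm).restrict
          one_le_two).trans (add_le_add ?_ (hφ.eLpNorm_translate_sub_le hΩ hΓ hv))
        refine (eLpNorm_restrict_le _ _ _ _).trans ?_
        refine (eLpNorm_sub_le (hmt _) (hm _) one_le_two).trans ?_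
        rw [eLpNorm_translate_indicator hΩm, eLpNorm_indicator_val hΩm]
    _ = ENNReal.ofReal (‖val (J - J')‖ + ‖val (J - J')‖ + ‖dirGrad v J'‖) := by
        rw [← eLpNorm_congr_ae (dirGrad_ae_eq hJ' v), ENNReal.ofReal_add (by positivity)
          (by positivity), ENNReal.ofReal_add (by positivity) (by positivity), Lp.norm_def
          (dirGrad v J'), ENNReal.ofReal_toReal (Lp.eLpNorm_ne_top _)]
    _ ≤ ENNReal.ofReal (‖dirGrad v J‖ + ε) := by
        apply ENNReal.ofReal_le_ofReal
        rw [dist_eq_norm] at hdist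
        have h1 := norm_val_le (J - J')
        have h2 := norm_dirGrad_le v (J - J')
        have h3 : ‖dirGrad v J'‖ ≤ ‖dirGrad v J‖ + ‖dirGrad v (J - J')‖ := by
          rw [dirGrad_sub]
          have := norm_sub_norm_le (dirGrad v J') (dirGrad v J)
          rw [norm_sub_rev] at this
          linarith
        have h4 : 3 * ‖v‖ * ‖J - J'‖ ≤ 3 * ‖v‖ * η := by gcongr
        have h5 : η * (2 + 3 * ‖v‖) = ε := div_mul_cancel₀ _ (by positivity)
        linarith
    _ = ENNReal.ofReal ‖dirGrad v J‖ + ε := by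
        rw [ENNReal.ofReal_add (by positivity) (by positivity), ENNReal.ofReal_coe_nnreal]

/-- Restricted to a set of points which the translation by `v` takes out of `Ω`, a function of
`H¹_Γ(Ω)` is controlled by its derivative along `v`. -/
theorem lintegral_exit_le (hΩ : IsOpen Ω) (hΓ : CoversUpperBdry Ω Γ) (hup : Ω ⊆ upperHalf) {v : E3}
    (hv : 0 ≤ v 2) {J : H1Jet Ω} (hJ : J ∈ H1Vanishing Ω Γ) :
    ∫⁻ x in {x ∈ Ω | x + v ∉ Ω}, ‖val J x‖ₑ ^ 2 ≤ ENNReal.ofReal ‖dirGrad v J‖ ^ 2 := by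
  have hms : MeasurableSet {x ∈ Ω | x + v ∉ Ω} :=
    hΩ.measurableSet.inter ((measurable_add_const v) hΩ.measurableSet).compl
  refine le_trans ?_ (eLpNorm_two_le_iff.1 (eLpNorm_translate_sub_le hΩ hΓ hv hJ))
  refine le_trans (le_of_eq ?_) (lintegral_mono_set (show {x ∈ Ω | x + v ∉ Ω} ⊆ upperHalf from
    fun x hx => hup hx.1))
  refine setLIntegral_congr_fun hms fun x hx => ?_
  simp [hx.1, hx.2]

theorem norm_val_le_of_exit (hΩ : IsOpen Ω) (hΓ : CoversUpperBdry Ω Γ) (hup : Ω ⊆ upperHalf)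
    {v : E3} (hv : 0 ≤ v 2) (hexit : ∀ x ∈ Ω, x + v ∉ Ω) {J : H1Jet Ω}
    (hJ : J ∈ H1Vanishing Ω Γ) : ‖val J‖ ≤ ‖dirGrad v J‖ := by
  have h := lintegral_exit_le hΩ hΓ hup hv hJ
  have : {x ∈ Ω | x + v ∉ Ω} = Ω := by
    ext x
    exact ⟨fun h => h.1, fun h => ⟨h, hexit x h⟩⟩
  rw [this, ← eLpNorm_two_le_iff, ← ENNReal.ofReal_toReal (Lp.eLpNorm_ne_top (val J)),
    ← Lp.norm_def] at h
  exact (ENNReal.ofReal_le_ofReal_iff (norm_nonneg _)).1 h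

end Extension

/-! ### Mollification -/

open scoped Convolution

theorem lintegral_enorm_sq_eq {f : E3 → ℝ} (hf : Continuous f) (hs : HasCompactSupport f) :
    ∫⁻ x, ‖f x‖ₑ ^ 2 = ENNReal.ofReal (∫ x, f x ^ 2) := by
  have hi : Integrable (fun x => f x ^ 2) := (hf.memLp_of_hasCompactSupport hs).integrable_sq
  rw [ofReal_integral_eq_lintegral_ofReal hi (Eventually.of_forall fun x => sq_nonneg _)]
  refine lintegral_congr fun x => ?_
  rw [← sq_abs, ENNReal.ofReal_pow (abs_nonneg _), ← Real.norm_eq_abs, ofReal_norm]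

/-- A mollifier of scale `δ` supported below the ground, with the scaling of its `L²` norms. -/
structure IsLowerMollifier (m δ : ℝ) (σ : E3 → ℝ) : Prop where
  contDiff : ContDiff ℝ ∞ σ
  hasCompactSupport : HasCompactSupport σ
  nonneg : ∀ x, 0 ≤ σ x
  integral_eq : ∫ x, σ x = 1
  support : ∀ x, σ x ≠ 0 → ‖x‖ < δ ∧ x 2 < 0
  lintegral_sq_le : ∫⁻ x, ‖σ x‖ₑ ^ 2 ≤ ENNReal.ofReal (m ^ 2 / δ ^ 3)
  lintegral_pderiv_sq_le : ∀ i, ∫⁻ x, ‖pderiv i σ x‖ₑ ^ 2 ≤ ENNReal.ofReal (m ^ 2 / δ ^ 5)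

theorem IsLowerMollifier.lintegral_enorm_eq {m δ : ℝ} {σ : E3 → ℝ} (hσ : IsLowerMollifier m δ σ) :
    ∫⁻ t, ‖σ t‖ₑ = 1 := by
  have hσi : Integrable σ :=
    hσ.contDiff.continuous.integrable_of_hasCompactSupport hσ.hasCompactSupport
  have := ofReal_integral_eq_lintegral_ofReal hσi (Eventually.of_forall hσ.nonneg)
  rw [hσ.integral_eq, ENNReal.ofReal_one] at this
  rw [this]
  refine lintegral_congr fun t => ?_
  rw [← ofReal_norm, Real.norm_of_nonneg (hσ.nonneg t)]

theorem continuous_pderiv {φ : E3 → ℝ} (h : ContDiff ℝ ∞ φ) (i : Fin 3) :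
    Continuous (pderiv i φ) :=
  (h.continuous_fderiv (by simp)).clm_apply continuous_const

theorem contDiff_pderiv {φ : E3 → ℝ} (h : ContDiff ℝ ∞ φ) (i : Fin 3) :
    ContDiff ℝ ∞ (pderiv i φ) :=
  (h.fderiv_right (m := ∞) (by simp)).clm_apply contDiff_const

theorem exists_isLowerMollifier : ∃ m : ℝ, 0 < m ∧ ∀ δ, 0 < δ → ∃ σ, IsLowerMollifier m δ σ := by
  let b : ContDiffBump ((-(1 / 2 : ℝ)) • vert) :=
    ⟨1 / 8, 1 / 4, by norm_num, by norm_num⟩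
  set ρ : E3 → ℝ := b.normed volume with hρ
  have hρ1 : ContDiff ℝ ∞ ρ := b.contDiff_normed
  have hρ2 : HasCompactSupport ρ := b.hasCompactSupport_normed
  have hρ3 : ∀ x, 0 ≤ ρ x := b.nonneg_normed
  have hρ4 : ∫ x, ρ x = 1 := b.integral_normed
  have hρ5 : ∀ x, ρ x ≠ 0 → ‖x‖ < 1 ∧ x 2 < 0 := by
    intro x hx
    have hx' : x ∈ Function.support ρ := hx
    rw [b.support_normed_eq, Metric.mem_ball] at hx'
    change dist x _ < 1 / 4 at hx'
    constructor
    · have h1 : ‖x‖ ≤ dist x ((-(1 / 2 : ℝ)) • vert) + ‖(-(1 / 2 : ℝ)) • vert‖ := by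
        rw [dist_eq_norm]
        simpa using norm_add_le (x - (-(1 / 2 : ℝ)) • vert) ((-(1 / 2 : ℝ)) • vert)
      have h2 : ‖(-(1 / 2 : ℝ)) • vert‖ = 1 / 2 := by
        rw [norm_smul]; simp [vert]
      linarith
    · have h1 := (abs_le.1 (abs_coord_sub_le_dist x ((-(1 / 2 : ℝ)) • vert) 2)).2
      have h2 : ((-(1 / 2 : ℝ)) • vert) 2 = -(1 / 2) := by simp
      rw [h2] at h1
      linarith
  set M : ℝ := 1 + (∫ x, ρ x ^ 2) + ∑ i, ∫ x, pderiv i ρ x ^ 2 with hM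
  have hI0 : 0 ≤ ∫ x, ρ x ^ 2 := integral_nonneg fun x => sq_nonneg _
  have hIi (i) : 0 ≤ ∫ x, pderiv i ρ x ^ 2 := integral_nonneg fun x => sq_nonneg _
  have hMpos : 1 ≤ M := by
    have := Finset.sum_nonneg fun i (_ : i ∈ Finset.univ) => hIi i
    linarith
  have hMsq : M ≤ M ^ 2 := by nlinarith
  have hM1 : ∫ x, ρ x ^ 2 ≤ M ^ 2 := by
    have := Finset.sum_nonneg fun i (_ : i ∈ Finset.univ) => hIi i
    linarith
  have hM2 (i) : ∫ x, pderiv i ρ x ^ 2 ≤ M ^ 2 := by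
    have := Finset.single_le_sum (fun i (_ : i ∈ Finset.univ) => hIi i) (Finset.mem_univ i)
    linarith
  refine ⟨M, by linarith, fun δ hδ => ⟨fun x => (δ ^ 3)⁻¹ * ρ (δ⁻¹ • x), ?_⟩⟩
  have hscale (f : E3 → ℝ) : ∫ x, f (δ⁻¹ • x) = δ ^ 3 * ∫ x, f x := by
    rw [Measure.integral_comp_smul]
    simp [abs_of_pos hδ]
  have hρδ : ContDiff ℝ ∞ fun x : E3 => ρ (δ⁻¹ • x) :=
    hρ1.comp (contDiff_const_smul (δ⁻¹ : ℝ))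
  have hc1 : ContDiff ℝ ∞ fun x : E3 => (δ ^ 3)⁻¹ * ρ (δ⁻¹ • x) := contDiff_const.mul hρδ
  have hc2 : HasCompactSupport fun x : E3 => (δ ^ 3)⁻¹ * ρ (δ⁻¹ • x) :=
    (hρ2.comp_smul (inv_ne_zero hδ.ne')).mul_left
  have hp (i : Fin 3) (x : E3) : pderiv i (fun x : E3 => (δ ^ 3)⁻¹ * ρ (δ⁻¹ • x)) x =
      (δ ^ 4)⁻¹ * pderiv i ρ (δ⁻¹ • x) := by
    have hd : DifferentiableAt ℝ (fun x : E3 => ρ (δ⁻¹ • x)) x :=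
      (hρδ.differentiable (by simp)).differentiableAt
    simp only [pderiv]
    rw [fderiv_const_mul hd, fderiv_comp_smul]
    simp only [smul_apply, smul_eq_mul]
    field_simp
  refine ⟨hc1, hc2, fun x => by have := hρ3 (δ⁻¹ • x); positivity, ?_, ?_, ?_, ?_⟩
  · rw [integral_const_mul, hscale, hρ4]
    field_simp
  · intro x hx
    obtain ⟨h1, h2⟩ := hρ5 _ (right_ne_zero_of_mul hx)
    rw [norm_smul, Real.norm_of_nonneg (by positivity), inv_mul_lt_iff₀ hδ, mul_one] at h1
    refine ⟨h1, ?_⟩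
    simp only [PiLp.smul_apply, smul_eq_mul] at h2
    exact (pos_iff_neg_of_mul_neg h2).1 (by positivity)
  · rw [lintegral_enorm_sq_eq hc1.continuous hc2]
    refine ENNReal.ofReal_le_ofReal ?_
    simp only [mul_pow]
    rw [integral_const_mul, hscale (fun x => ρ x ^ 2)]
    calc ((δ ^ 3)⁻¹) ^ 2 * (δ ^ 3 * ∫ x, ρ x ^ 2) = (∫ x, ρ x ^ 2) / δ ^ 3 := by field_simp
      _ ≤ M ^ 2 / δ ^ 3 := by gcongr
  · intro i
    rw [lintegral_enorm_sq_eq (continuous_pderiv hc1 i) (hc2.fderiv_apply ℝ _)]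
    refine ENNReal.ofReal_le_ofReal ?_
    simp only [hp, mul_pow]
    rw [integral_const_mul, hscale (fun x => pderiv i ρ x ^ 2)]
    calc ((δ ^ 4)⁻¹) ^ 2 * (δ ^ 3 * ∫ x, pderiv i ρ x ^ 2) = (∫ x, pderiv i ρ x ^ 2) / δ ^ 5 := by
          field_simp
      _ ≤ M ^ 2 / δ ^ 5 := by gcongr; exact hM2 i

theorem sq_enorm_integral_mul_sub_le {f g : E3 → ℝ} (hf : Continuous f) (hg : Measurable g)
    (x : E3) : ‖∫ t, f t * g (x - t)‖ₑ ^ 2 ≤ (∫⁻ t, ‖f t‖ₑ ^ 2) * ∫⁻ t, ‖g t‖ₑ ^ 2 := by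
  have hgm : Measurable fun t => g (x - t) := hg.comp (measurable_const.sub measurable_id)
  calc ‖∫ t, f t * g (x - t)‖ₑ ^ 2 ≤ (∫⁻ t, ‖f t‖ₑ * ‖g (x - t)‖ₑ) ^ 2 := by
        refine pow_le_pow_left' ((enorm_integral_le_lintegral_enorm _).trans (le_of_eq ?_)) 2
        simp only [enorm_mul]
    _ ≤ (∫⁻ t, ‖f t‖ₑ ^ 2) * ∫⁻ t, ‖g (x - t)‖ₑ ^ 2 :=
        sq_lintegral_mul_le hf.enorm.measurable.aemeasurable hgm.enorm.aemeasurable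
    _ = _ := by rw [lintegral_sub_left_eq_self (fun t => ‖g t‖ₑ ^ 2) x]

theorem pderiv_convolution {σ g : E3 → ℝ} (hσ : ContDiff ℝ ∞ σ) (hs : HasCompactSupport σ)
    (hg : LocallyIntegrable g) (i : Fin 3) (x : E3) :
    pderiv i (σ ⋆[ContinuousLinearMap.lsmul ℝ ℝ] g) x = ∫ t, pderiv i σ t * g (x - t) := by
  have h1 := hs.hasFDerivAt_convolution_left (ContinuousLinearMap.lsmul ℝ ℝ)
    (hσ.of_le (by simp)) hg x
  have h2 := (hs.fderiv ℝ).convolutionExists_left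
    (ContinuousLinearMap.precompL E3 (ContinuousLinearMap.lsmul ℝ ℝ : ℝ →L[ℝ] ℝ →L[ℝ] ℝ))
    (hσ.continuous_fderiv (by simp)) hg x
  rw [pderiv, h1.fderiv, convolution_def, ContinuousLinearMap.integral_apply h2]
  rfl

theorem abs_le_of_enorm_sq_le {a b : ℝ} (hb : 0 ≤ b) (h : ‖a‖ₑ ^ 2 ≤ ENNReal.ofReal (b ^ 2)) :
    |a| ≤ b := by
  rw [ENNReal.ofReal_pow hb, ENNReal.pow_le_pow_left_iff two_ne_zero, ← ofReal_norm] at h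
  exact (ENNReal.ofReal_le_ofReal_iff hb).1 h

theorem two_mul_ofReal (a : ℝ) : 2 * ENNReal.ofReal a = ENNReal.ofReal (2 * a) := by
  rw [ENNReal.ofReal_mul zero_le_two, ENNReal.ofReal_ofNat]

theorem enorm_add_sq_le {a b : ℝ} : ‖a + b‖ₑ ^ 2 ≤ 2 * (‖a‖ₑ ^ 2 + ‖b‖ₑ ^ 2) := by
  simp only [← ofReal_norm, ← ENNReal.ofReal_pow (norm_nonneg _)]
  rw [← ENNReal.ofReal_add (by positivity) (by positivity), two_mul_ofReal]
  apply ENNReal.ofReal_le_ofReal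
  simp only [Real.norm_eq_abs, sq_abs]
  nlinarith [sq_nonneg (a - b)]

/-- Mollifying with a kernel supported below the ground and of unit mass: the error is an average
of the errors made by upward translations. -/
theorem sq_enorm_convolution_sub_le {σ g : E3 → ℝ} {m δ : ℝ} (hσ : IsLowerMollifier m δ σ)
    (hg : Measurable g) (hgi : LocallyIntegrable g) (x : E3) (c : ℝ) :
    ‖(∫ t, σ t * g (x - t)) - c‖ₑ ^ 2 ≤ ∫⁻ t, ‖σ t‖ₑ * ‖g (x - t) - c‖ₑ ^ 2 := by
  have hσc := hσ.contDiff.continuous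
  have hgm : Measurable fun t => ‖g (x - t) - c‖ₑ :=
    ((hg.comp (measurable_const.sub measurable_id)).sub_const c).enorm
  have hi : Integrable fun t => σ t * g (x - t) :=
    hσ.hasCompactSupport.convolutionExists_left (ContinuousLinearMap.lsmul ℝ ℝ) hσc hgi x
  have hσi : Integrable σ := hσc.integrable_of_hasCompactSupport hσ.hasCompactSupport
  have h1 : (∫ t, σ t * g (x - t)) - c = ∫ t, σ t * (g (x - t) - c) := by
    simp only [mul_sub]
    rw [integral_sub hi (hσi.mul_const c), integral_mul_const, hσ.integral_eq, one_mul]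
  have hσm : Measurable fun t => ‖σ t‖ₑ := hσc.enorm.measurable
  have h2 := sq_lintegral_le (μ := volume.withDensity fun t => ‖σ t‖ₑ) hgm.aemeasurable
  rw [withDensity_apply _ MeasurableSet.univ, setLIntegral_univ, hσ.lintegral_enorm_eq, one_mul,
    lintegral_withDensity_eq_lintegral_mul _ hσm hgm,
    lintegral_withDensity_eq_lintegral_mul _ hσm (hgm.pow_const 2)] at h2
  rw [h1]
  refine (pow_le_pow_left' (enorm_integral_le_lintegral_enorm _) 2).trans ?_
  simpa only [enorm_mul, Pi.mul_apply] using h2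

section Regularization

variable {Ω Γ : Set E3}

/-- A function of `H¹_Γ(Ω)` is small in `L²` near `Γ`. -/
theorem lintegral_thickening_le (hΩ : IsOpen Ω) (hΓ : CoversUpperBdry Ω Γ) (hup : Ω ⊆ upperHalf)
    {A : Finset E3} (hA : ∀ a ∈ A, 0 ≤ a 2) {δ : ℝ} (hδ : 0 < δ)
    (hexit : ∀ x ∈ Ω, ∀ y ∈ Γ, dist x y < 2 * δ → ∃ a ∈ A, x + δ • a ∉ Ω)
    {J : H1Jet Ω} (hJ : J ∈ H1Vanishing Ω Γ) :
    ∫⁻ x in Ω ∩ Metric.thickening (2 * δ) Γ, ‖val J x‖ₑ ^ 2 ≤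
      ENNReal.ofReal (∑ a ∈ A, (3 * ‖a‖) ^ 2 * (δ * ‖J‖) ^ 2) := by
  set S : E3 → Set E3 := fun a => {x ∈ Ω | x + δ • a ∉ Ω} with hS
  have hSm (a : E3) : MeasurableSet (S a) :=
    hΩ.measurableSet.inter ((measurable_add_const (δ • a)) hΩ.measurableSet).compl
  have hTm : MeasurableSet (Ω ∩ Metric.thickening (2 * δ) Γ) :=
    hΩ.measurableSet.inter Metric.isOpen_thickening.measurableSet
  set F : E3 → ℝ≥0∞ := fun x => ‖val J x‖ₑ ^ 2
  have hF : Measurable F := (Lp.stronglyMeasurable (val J)).measurable.enorm.pow_const 2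
  calc ∫⁻ x in Ω ∩ Metric.thickening (2 * δ) Γ, F x
      = ∫⁻ x, (Ω ∩ Metric.thickening (2 * δ) Γ).indicator F x := (lintegral_indicator hTm _).symm
    _ ≤ ∫⁻ x, ∑ a ∈ A, (S a).indicator F x := by
        refine lintegral_mono fun x => ?_
        by_cases hx : x ∈ Ω ∩ Metric.thickening (2 * δ) Γ
        · obtain ⟨y, hy, hxy⟩ := Metric.mem_thickening_iff.1 hx.2
          obtain ⟨a, ha, hxa⟩ := hexit x hx.1 y hy hxy
          rw [indicator_of_mem hx, ← indicator_of_mem (show x ∈ S a from ⟨hx.1, hxa⟩) F]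
          exact Finset.single_le_sum (f := fun a => (S a).indicator F x)
            (fun _ _ => zero_le) ha
        · rw [indicator_of_notMem hx]
          exact zero_le
    _ = ∑ a ∈ A, ∫⁻ x in S a, F x := by
        rw [lintegral_finsetSum _ fun a _ => hF.indicator (hSm a)]
        exact Finset.sum_congr rfl fun a _ => lintegral_indicator (hSm a) _
    _ ≤ ∑ a ∈ A, ENNReal.ofReal ((3 * ‖a‖) ^ 2 * (δ * ‖J‖) ^ 2) := by
        refine Finset.sum_le_sum fun a ha => ?_
        refine (lintegral_exit_le hΩ hΓ hup (v := δ • a)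
          (by simpa using mul_nonneg hδ.le (hA a ha)) hJ).trans ?_
        rw [← ENNReal.ofReal_pow (norm_nonneg _)]
        refine ENNReal.ofReal_le_ofReal ?_
        rw [← mul_pow]
        refine pow_le_pow_left₀ (norm_nonneg _) ((norm_dirGrad_le _ _).trans (le_of_eq ?_)) 2
        rw [norm_smul, Real.norm_of_nonneg hδ.le]
        ring
    _ = _ := (ENNReal.ofReal_sum_of_nonneg fun a _ => by positivity).symm

/-- Functions of `H¹_Γ(Ω)` are approximated in `L²` at rate `δ` by smooth functions vanishing near
`Γ` whose gradient is at most of order `δ^(-5/2)`; the scale is written `δ = η²`. -/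
theorem exists_regularization (hΩ : IsOpen Ω) (hΓ : CoversUpperBdry Ω Γ) (hup : Ω ⊆ upperHalf)
    {A : Finset E3} (hA : ∀ a ∈ A, 0 ≤ a 2) {δ₀ : ℝ}
    (hexit : ∀ δ, 0 < δ → δ ≤ δ₀ → ∀ x ∈ Ω, ∀ y ∈ Γ, dist x y < 2 * δ →
      ∃ a ∈ A, x + δ • a ∉ Ω) :
    ∃ c : ℝ, 0 < c ∧ ∀ η : ℝ, 0 < η → η ≤ 1 → η ^ 2 ≤ δ₀ → ∀ J ∈ H1Vanishing Ω Γ,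
      ∃ φ : E3 → ℝ, IsSmoothVanishingNear Ω Γ φ ∧ (∀ x, |φ x| ≤ c / η ^ 5 * ‖val J‖) ∧
        (∀ i x, |pderiv i φ x| ≤ c / η ^ 5 * ‖val J‖) ∧
        eLpNorm (fun x => φ x - val J x) 2 (volume.restrict Ω) ≤
          ENNReal.ofReal (c * η ^ 2 * ‖J‖) := by
  obtain ⟨m, hm, hmol⟩ := exists_isLowerMollifier
  set Q : ℝ := ∑ a ∈ A, (3 * ‖a‖) ^ 2 with hQ
  have hQ0 : 0 ≤ Q := Finset.sum_nonneg fun a _ => by positivity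
  set c : ℝ := m + (2 * (Q + 9) + 1) with hc
  refine ⟨c, by positivity, fun η hη hη1 hηδ J hJ => ?_⟩
  set δ := η ^ 2 with hδ
  have hδ0 : 0 < δ := by positivity
  obtain ⟨σ, hσ⟩ := hmol δ hδ0
  have hσc := hσ.contDiff.continuous
  have hΩm := hΩ.measurableSet
  have hTm : MeasurableSet (Metric.thickening (2 * δ) Γ) :=
    Metric.isOpen_thickening.measurableSet
  have hJm : Measurable (val J) := (Lp.stronglyMeasurable (val J)).measurable
  set w : E3 → ℝ := Ω.indicator (val J) with hw
  have hwm : Measurable w := hJm.indicator hΩm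
  -- The function is cut off near `Γ` before it is mollified.
  set g : E3 → ℝ := (Ω \ Metric.thickening (2 * δ) Γ).indicator (val J) with hg
  have hgm : Measurable g := hJm.indicator (hΩm.diff hTm)
  have hw2 : ∫⁻ x, ‖w x‖ₑ ^ 2 = ENNReal.ofReal (‖val J‖ ^ 2) := by
    rw [← eLpNorm_two_sq, eLpNorm_indicator_val hΩm, ENNReal.ofReal_pow (norm_nonneg _)]
  have hgw : ∀ x, ‖g x‖ₑ ≤ ‖w x‖ₑ := by
    intro x
    rw [hg, hw, enorm_indicator_eq_indicator_enorm, enorm_indicator_eq_indicator_enorm]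
    exact indicator_le_indicator_of_subset sdiff_subset (fun _ => zero_le) x
  have hg2 : ∫⁻ x, ‖g x‖ₑ ^ 2 ≤ ENNReal.ofReal (‖val J‖ ^ 2) :=
    (lintegral_mono fun x => pow_le_pow_left' (hgw x) 2).trans_eq hw2
  have hgL : MemLp g 2 volume :=
    ⟨hgm.aestronglyMeasurable, by
      have := eLpNorm_two_le_iff.2 (hg2.trans_eq (ENNReal.ofReal_pow (norm_nonneg (val J)) 2))
      exact this.trans_lt ENNReal.ofReal_lt_top⟩
  have hgi : LocallyIntegrable g := hgL.locallyIntegrable one_le_two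
  have hφ (x : E3) : (σ ⋆[ContinuousLinearMap.lsmul ℝ ℝ] g) x = ∫ t, σ t * g (x - t) := rfl
  have hη5 : 0 < η ^ 5 := by positivity
  have hmc : m ≤ c := by simp only [hc]; linarith
  refine ⟨σ ⋆[ContinuousLinearMap.lsmul ℝ ℝ] g, ⟨?_, ?_⟩, ?_, ?_, ?_⟩
  · exact hσ.hasCompactSupport.contDiff_convolution_left _ hσ.contDiff hgi
  · refine ⟨Metric.thickening δ Γ, Metric.isOpen_thickening,
      Metric.self_subset_thickening hδ0 Γ, fun x hx => ?_⟩
    rw [hφ]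
    refine integral_eq_zero_of_ae (Eventually.of_forall fun t => ?_)
    by_cases ht : σ t = 0
    · simp [ht]
    obtain ⟨y, hy, hxy⟩ := Metric.mem_thickening_iff.1 hx.1
    have hmem : x - t ∈ Metric.thickening (2 * δ) Γ := by
      refine Metric.mem_thickening_iff.2 ⟨y, hy, ?_⟩
      have h1 := (hσ.support t ht).1
      have h2 := dist_triangle (x - t) x y
      rw [dist_comm (x - t) x, dist_self_sub_right] at h2
      linarith
    have : g (x - t) = 0 := indicator_of_notMem (fun h => h.2 hmem) _
    simp [this]
  · intro x
    refine abs_le_of_enorm_sq_le (by positivity) ?_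
    rw [hφ]
    refine (sq_enorm_integral_mul_sub_le hσc hgm x).trans
      ((mul_le_mul' hσ.lintegral_sq_le hg2).trans ?_)
    rw [← ENNReal.ofReal_mul (by positivity)]
    refine ENNReal.ofReal_le_ofReal ?_
    rw [mul_pow, div_pow]
    gcongr
    calc (η ^ 5) ^ 2 = δ ^ 3 * η ^ 4 := by rw [hδ]; ring
      _ ≤ δ ^ 3 := mul_le_of_le_one_right (by positivity) (pow_le_one₀ hη.le hη1)
  · intro i x
    refine abs_le_of_enorm_sq_le (by positivity) ?_
    rw [pderiv_convolution hσ.contDiff hσ.hasCompactSupport hgi]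
    refine (sq_enorm_integral_mul_sub_le (continuous_pderiv hσ.contDiff i) hgm x).trans
      ((mul_le_mul' (hσ.lintegral_pderiv_sq_le i) hg2).trans ?_)
    rw [← ENNReal.ofReal_mul (by positivity)]
    refine ENNReal.ofReal_le_ofReal ?_
    rw [mul_pow, div_pow]
    gcongr
    exact le_of_eq (by rw [hδ]; ring)
  · rw [eLpNorm_two_le_iff]
    -- the part of the function that is cut off
    set k : E3 → ℝ := fun x => g x - w x with hk
    have hkm : Measurable k := hgm.sub hwm
    have hk2 : ∫⁻ x, ‖k x‖ₑ ^ 2 ≤ ENNReal.ofReal (Q * (δ * ‖J‖) ^ 2) := by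
      have := lintegral_thickening_le hΩ hΓ hup hA hδ0 (hexit δ hδ0 hηδ) hJ
      rw [← Finset.sum_mul, ← lintegral_indicator (hΩm.inter hTm)] at this
      refine (lintegral_mono fun x => ?_).trans this
      by_cases hx : x ∈ Ω <;> by_cases hx' : x ∈ Metric.thickening (2 * δ) Γ <;>
        simp [hk, hg, hw, hx, hx']
    have htrans (t : E3) (ht : σ t ≠ 0) : ∫⁻ x in Ω, ‖g (x - t) - w x‖ₑ ^ 2 ≤
        ENNReal.ofReal (2 * (Q + 9) * (δ * ‖J‖) ^ 2) := by
      obtain ⟨ht1, ht2⟩ := hσ.support t ht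
      have ht3 : 0 ≤ (-t) 2 := by simp; linarith
      have e1 : ∫⁻ x, ‖k (x - t)‖ₑ ^ 2 ≤ ENNReal.ofReal (Q * (δ * ‖J‖) ^ 2) := by
        rwa [lintegral_sub_right_eq_self (fun x => ‖k x‖ₑ ^ 2) t]
      have e2 : ∫⁻ x in upperHalf, ‖w (x + -t) - w x‖ₑ ^ 2 ≤
          ENNReal.ofReal ((3 * (δ * ‖J‖)) ^ 2) := by
        refine (eLpNorm_two_le_iff.1 (eLpNorm_translate_sub_le hΩ hΓ ht3 hJ)).trans ?_
        rw [← ENNReal.ofReal_pow (norm_nonneg _)]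
        refine ENNReal.ofReal_le_ofReal
          (pow_le_pow_left₀ (norm_nonneg _) ((norm_dirGrad_le _ _).trans ?_) 2)
        rw [norm_neg, mul_assoc]
        gcongr
      calc ∫⁻ x in Ω, ‖g (x - t) - w x‖ₑ ^ 2
          ≤ ∫⁻ x in upperHalf, ‖g (x - t) - w x‖ₑ ^ 2 := lintegral_mono_set hup
        _ ≤ ∫⁻ x in upperHalf, 2 * (‖k (x - t)‖ₑ ^ 2 + ‖w (x + -t) - w x‖ₑ ^ 2) := by
            refine lintegral_mono fun x => ?_
            refine le_trans (le_of_eq ?_) enorm_add_sq_le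
            simp only [hk]
            congr 2
            rw [← sub_eq_add_neg]
            ring
        _ = 2 * ((∫⁻ x in upperHalf, ‖k (x - t)‖ₑ ^ 2) +
              ∫⁻ x in upperHalf, ‖w (x + -t) - w x‖ₑ ^ 2) := by
            rw [lintegral_const_mul' _ _ (by simp), lintegral_add_left]
            exact (hkm.comp (measurable_id.sub_const t)).enorm.pow_const 2
        _ ≤ 2 * (ENNReal.ofReal (Q * (δ * ‖J‖) ^ 2) + ENNReal.ofReal ((3 * (δ * ‖J‖)) ^ 2)) := by
            gcongr
            exact (setLIntegral_le_lintegral _ _).trans e1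
        _ = _ := by
            rw [← ENNReal.ofReal_add (by positivity) (by positivity), two_mul_ofReal]
            congr 1
            ring
    have hmeas : Measurable fun p : E3 × E3 => ‖σ p.2‖ₑ * ‖g (p.1 - p.2) - w p.1‖ₑ ^ 2 :=
      (hσc.enorm.measurable.comp measurable_snd).mul
        ((((hgm.comp (measurable_fst.sub measurable_snd)).sub
          (hwm.comp measurable_fst)).enorm).pow_const 2)
    calc ∫⁻ x in Ω, ‖(σ ⋆[ContinuousLinearMap.lsmul ℝ ℝ] g) x - val J x‖ₑ ^ 2
        ≤ ∫⁻ x in Ω, ∫⁻ t, ‖σ t‖ₑ * ‖g (x - t) - w x‖ₑ ^ 2 := by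
          refine setLIntegral_mono' hΩm fun x hx => ?_
          have : val J x = w x := by simp [hw, hx]
          rw [hφ, this]
          exact sq_enorm_convolution_sub_le hσ hgm hgi x (w x)
      _ = ∫⁻ t, ∫⁻ x in Ω, ‖σ t‖ₑ * ‖g (x - t) - w x‖ₑ ^ 2 :=
          lintegral_lintegral_swap hmeas.aemeasurable
      _ ≤ ∫⁻ t, ‖σ t‖ₑ * ENNReal.ofReal (2 * (Q + 9) * (δ * ‖J‖) ^ 2) := by
          refine lintegral_mono fun t => ?_
          rw [lintegral_const_mul' _ _ (by simp)]
          by_cases ht : σ t = 0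
          · simp [ht]
          · gcongr
            exact htrans t ht
      _ = ENNReal.ofReal (2 * (Q + 9) * (δ * ‖J‖) ^ 2) := by
          rw [lintegral_mul_const' _ _ (by simp), hσ.lintegral_enorm_eq, one_mul]
      _ ≤ ENNReal.ofReal (c * δ * ‖J‖) ^ 2 := by
          rw [← ENNReal.ofReal_pow (by positivity)]
          refine ENNReal.ofReal_le_ofReal ?_
          have hcc : 2 * (Q + 9) ≤ c ^ 2 := by
            have : 2 * (Q + 9) + 1 ≤ c := by simp only [hc]; linarith
            nlinarith
          calc 2 * (Q + 9) * (δ * ‖J‖) ^ 2 ≤ c ^ 2 * (δ * ‖J‖) ^ 2 := by gcongr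
            _ = (c * δ * ‖J‖) ^ 2 := by ring

end Regularization

/-! ### Functions of time -/

instance (T : ℝ) : IsFiniteMeasure (timeMeasure T) := by
  unfold timeMeasure
  infer_instance

theorem intervalIntegral_eq_integral_timeMeasure {T : ℝ} (hT : 0 ≤ T) (f : ℝ → ℝ) :
    ∫ t in (0 : ℝ)..T, f t = ∫ t, f t ∂(timeMeasure T) := by
  rw [intervalIntegral.integral_of_le hT, integral_Ioc_eq_integral_Ioo, timeMeasure]

theorem ae_timeMeasure_mem (T : ℝ) : ∀ᵐ t ∂(timeMeasure T), t ∈ Ioo 0 T :=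
  ae_restrict_mem measurableSet_Ioo

theorem ae_timeMeasure_mono {T T' : ℝ} (h : T' ≤ T) {p : ℝ → Prop}
    (hp : ∀ᵐ t ∂(timeMeasure T), p t) : ∀ᵐ t ∂(timeMeasure T'), p t :=
  ae_mono (Measure.restrict_mono_set _ (Ioo_subset_Ioo_right h)) hp

theorem ae_timeMeasure_shift {T h : ℝ} (h0 : 0 ≤ h) {p : ℝ → Prop}
    (hp : ∀ᵐ t ∂(timeMeasure T), p t) : ∀ᵐ t ∂(timeMeasure (T - h)), p (t + h) := by
  rw [timeMeasure, ae_restrict_iff' measurableSet_Ioo] at hp ⊢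
  filter_upwards [(measurePreserving_add_right volume h).quasiMeasurePreserving.ae hp] with t ht ht'
  exact ht ⟨by linarith [ht'.1], by linarith [ht'.2]⟩

theorem integrable_timeMeasure_iff_intervalIntegrable {T : ℝ} (hT : 0 ≤ T) {f : ℝ → ℝ} :
    Integrable f (timeMeasure T) ↔ IntervalIntegrable f volume 0 T := by
  rw [intervalIntegrable_iff_integrableOn_Ioo_of_le hT, timeMeasure, IntegrableOn]

theorem intervalIntegrable_of_timeMeasure {T : ℝ} {f : ℝ → ℝ} (hf : Integrable f (timeMeasure T))
    {a b : ℝ} (ha : 0 ≤ a) (hab : a ≤ b) (hb : b ≤ T) : IntervalIntegrable f volume a b := by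
  have hT : 0 ≤ T := ha.trans (hab.trans hb)
  refine ((integrable_timeMeasure_iff_intervalIntegrable hT).1 hf).mono_set ?_
  rw [uIcc_of_le hab, uIcc_of_le hT]
  exact Icc_subset_Icc ha hb

theorem intervalIntegral_indicator_lt {T s : ℝ} (hs : s ∈ Ioo 0 T) (f : ℝ → ℝ) :
    ∫ t in s..T, f t = ∫ t, (Ioi s).indicator f t ∂(timeMeasure T) := by
  rw [intervalIntegral.integral_of_le hs.2.le, integral_Ioc_eq_integral_Ioo,
    integral_indicator measurableSet_Ioi, timeMeasure, Measure.restrict_restrict measurableSet_Ioi]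
  congr 2
  ext t
  simp only [mem_Ioo, mem_inter_iff, mem_Ioi]
  exact ⟨fun h => ⟨h.1, hs.1.trans h.1, h.2⟩, fun h => ⟨h.1, h.2.2⟩⟩

theorem intervalIntegral_indicator_gt {T t : ℝ} (ht : t ∈ Ioo 0 T) (f : ℝ → ℝ) :
    ∫ s in (0 : ℝ)..t, f s = ∫ s, (Iio t).indicator f s ∂(timeMeasure T) := by
  rw [intervalIntegral.integral_of_le ht.1.le, integral_Ioc_eq_integral_Ioo,
    integral_indicator measurableSet_Iio, timeMeasure, Measure.restrict_restrict measurableSet_Iio]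
  congr 2
  ext s
  simp only [mem_Ioo, mem_inter_iff, mem_Iio]
  exact ⟨fun h => ⟨h.2, h.1, h.2.trans ht.2⟩, fun h => ⟨h.2.1, h.1⟩⟩

/-- The primitive, vanishing at time `T`, of the indicator function of `A`. -/
noncomputable def hatFunction (T : ℝ) (A : Set ℝ) (t : ℝ) : ℝ :=
  -∫ s in t..T, A.indicator 1 s

theorem integrable_indicator_one {T : ℝ} {A : Set ℝ} (hA : MeasurableSet A) :
    Integrable (A.indicator (1 : ℝ → ℝ)) (timeMeasure T) :=
  (integrable_const (1 : ℝ)).indicator hA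

theorem continuous_hatFunction (T : ℝ) {A : Set ℝ} (hA : MeasurableSet A) :
    Continuous (hatFunction T A) := by
  have hloc : ∀ a b : ℝ, IntervalIntegrable (A.indicator (1 : ℝ → ℝ)) volume a b := fun a b =>
    ⟨(integrable_const (1 : ℝ)).indicator hA, (integrable_const (1 : ℝ)).indicator hA⟩
  have : hatFunction T A = fun t => ∫ s in T..t, A.indicator 1 s := by
    funext t
    rw [hatFunction, intervalIntegral.integral_symm t T]
  rw [this]
  exact intervalIntegral.continuous_primitive hloc T

/-- Fubini's theorem in the form of an integration by parts. -/
theorem integral_hatFunction_mul {T : ℝ} {A : Set ℝ} (hA : MeasurableSet A) {F : ℝ → ℝ}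
    (hF : Integrable F (timeMeasure T)) :
    Integrable (fun t => A.indicator 1 t * ∫ s in (0 : ℝ)..t, F s) (timeMeasure T) ∧
    ∫ s, hatFunction T A s * F s ∂(timeMeasure T) =
      -∫ t, A.indicator 1 t * (∫ s in (0 : ℝ)..t, F s) ∂(timeMeasure T) := by
  set P : ℝ × ℝ → ℝ := {p : ℝ × ℝ | p.1 < p.2}.indicator fun p => F p.1 * A.indicator 1 p.2
    with hP
  have hint : Integrable P ((timeMeasure T).prod (timeMeasure T)) :=
    (hF.mul_prod (integrable_indicator_one hA)).indicator
      (measurableSet_lt measurable_fst measurable_snd)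
  have h1 (t : ℝ) (ht : t ∈ Ioo 0 T) :
      ∫ s, P (s, t) ∂(timeMeasure T) = A.indicator 1 t * ∫ s in (0 : ℝ)..t, F s := by
    rw [intervalIntegral_indicator_gt ht, ← integral_const_mul]
    refine integral_congr_ae (Eventually.of_forall fun s => ?_)
    by_cases hst : s < t
    · simp [hP, indicator, hst, mul_comm]
    · simp [hP, indicator, hst]
  have h2 (s : ℝ) (hs : s ∈ Ioo 0 T) :
      ∫ t, P (s, t) ∂(timeMeasure T) = -(hatFunction T A s * F s) := by
    rw [hatFunction, intervalIntegral_indicator_lt hs, neg_mul, neg_neg, mul_comm,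
      ← integral_const_mul]
    refine integral_congr_ae (Eventually.of_forall fun t => ?_)
    by_cases hst : s < t
    · simp [hP, indicator, hst]
    · simp [hP, indicator, hst]
  constructor
  · refine hint.integral_prod_right.congr ?_
    filter_upwards [ae_timeMeasure_mem T] with t ht using h1 t ht
  · calc ∫ s, hatFunction T A s * F s ∂(timeMeasure T)
        = -∫ s, ∫ t, P (s, t) ∂(timeMeasure T) ∂(timeMeasure T) := by
          rw [← integral_neg]
          refine integral_congr_ae ?_
          filter_upwards [ae_timeMeasure_mem T] with s hs
          rw [h2 s hs, neg_neg]
      _ = -∫ t, ∫ s, P (s, t) ∂(timeMeasure T) ∂(timeMeasure T) := by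
          rw [integral_integral_swap (f := fun s t => P (s, t)) hint]
      _ = _ := by
          congr 1
          refine integral_congr_ae ?_
          filter_upwards [ae_timeMeasure_mem T] with t ht using h1 t ht

/-- A weak solution of `g' = F`, `g(0) = g₀` is given almost everywhere by the integral of `F`. -/
theorem ae_eq_add_integral_of_weak {T : ℝ} (hT : 0 ≤ T) {g F : ℝ → ℝ} {g₀ : ℝ}
    (hg : Integrable g (timeMeasure T)) (hF : Integrable F (timeMeasure T))
    (hweak : ∀ A : Set ℝ, MeasurableSet A →
      -(∫ t, A.indicator 1 t * g t ∂(timeMeasure T)) -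
        ∫ t, hatFunction T A t * F t ∂(timeMeasure T) = hatFunction T A 0 * g₀) :
    ∀ᵐ t ∂(timeMeasure T), g t = g₀ + ∫ s in (0 : ℝ)..t, F s := by
  have hprim : Integrable (fun t => ∫ s in (0 : ℝ)..t, F s) (timeMeasure T) := by
    simpa using (integral_hatFunction_mul MeasurableSet.univ hF).1
  have hzero : (fun t => g t - (g₀ + ∫ s in (0 : ℝ)..t, F s)) =ᵐ[timeMeasure T] 0 := by
    refine (hg.sub ((integrable_const g₀).add hprim)).ae_eq_zero_of_forall_setIntegral_eq_zero ?_
    intro A hA _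
    have h1 := hweak A hA
    obtain ⟨h2, h3⟩ := integral_hatFunction_mul hA hF
    have h4 : hatFunction T A 0 * g₀ = -∫ t, A.indicator 1 t * g₀ ∂(timeMeasure T) := by
      rw [hatFunction, intervalIntegral_eq_integral_timeMeasure hT, integral_mul_const, neg_mul]
    have hmul (f : ℝ → ℝ) (hf : Integrable f (timeMeasure T)) :
        Integrable (fun t => A.indicator 1 t * f t) (timeMeasure T) := by
      refine (hf.indicator hA).congr (Eventually.of_forall fun t => ?_)
      by_cases ht : t ∈ A <;> simp [ht]
    rw [← integral_indicator hA]
    calc ∫ t, A.indicator (g - ((fun _ => g₀) + fun t => ∫ s in (0 : ℝ)..t, F s)) t ∂(timeMeasure T)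
        = ∫ t, (A.indicator 1 t * g t - (A.indicator 1 t * g₀ +
            A.indicator 1 t * ∫ s in (0 : ℝ)..t, F s)) ∂(timeMeasure T) := by
          refine integral_congr_ae (Eventually.of_forall fun t => ?_)
          by_cases ht : t ∈ A <;> simp [ht]
      _ = 0 := by
          have h5 : Integrable (fun t => A.indicator 1 t * g₀ +
              A.indicator 1 t * ∫ s in (0 : ℝ)..t, F s) (timeMeasure T) :=
            (hmul _ (integrable_const g₀)).add h2
          rw [integral_sub (hmul g hg) h5,
            integral_add (hmul _ (integrable_const g₀)) h2]
          linarith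
  filter_upwards [hzero] with t ht
  simpa [sub_eq_zero] using ht

theorem integrable_inner_of_memLp {T : ℝ} {H : Type*} [NormedAddCommGroup H]
    [InnerProductSpace ℝ H] {f g : ℝ → H} (hf : MemLp f 2 (timeMeasure T))
    (hg : MemLp g 2 (timeMeasure T)) :
    Integrable (fun t => (inner ℝ (f t) (g t) : ℝ)) (timeMeasure T) := by
  refine Integrable.mono' (hf.norm.integrable_mul hg.norm) (hf.1.inner hg.1)
    (Eventually.of_forall fun t => ?_)
  simpa using norm_inner_le_norm (𝕜 := ℝ) (f t) (g t)

/-! ### Jets of smooth functions and multiplication operators -/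

section Jets

variable {Ω : Set E3}

/-- The value of a jet, as a continuous linear map. -/
noncomputable def valL : H1Jet Ω →L[ℝ] L2 Ω :=
  PiLp.proj 2 (𝕜 := ℝ) (fun _ : Option (Fin 3) => L2 Ω) none

/-- A partial derivative of a jet, as a continuous linear map. -/
noncomputable def gradL (i : Fin 3) : H1Jet Ω →L[ℝ] L2 Ω :=
  PiLp.proj 2 (𝕜 := ℝ) (fun _ : Option (Fin 3) => L2 Ω) (some i)

theorem memLp_val {T : ℝ} {C : ℝ → H1Jet Ω} {p : ℝ≥0∞} (hC : MemLp C p (timeMeasure T)) :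
    MemLp (fun t => val (C t)) p (timeMeasure T) :=
  (valL (Ω := Ω)).comp_memLp' hC

theorem memLp_grad {T : ℝ} {C : ℝ → H1Jet Ω} {p : ℝ≥0∞} (hC : MemLp C p (timeMeasure T))
    (i : Fin 3) : MemLp (fun t => grad (C t) i) p (timeMeasure T) :=
  (gradL (Ω := Ω) i).comp_memLp' hC

theorem memLp_component {T : ℝ} {u : ℝ → Fin 3 → H1Jet Ω} {p : ℝ≥0∞}
    (hu : MemLp u p (timeMeasure T)) (i : Fin 3) : MemLp (fun t => u t i) p (timeMeasure T) :=
  (ContinuousLinearMap.proj (R := ℝ) (φ := fun _ : Fin 3 => H1Jet Ω) i).comp_memLp' hu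

theorem isFiniteMeasure_restrict_of_isBounded (hΩ : Bornology.IsBounded Ω) :
    IsFiniteMeasure (volume.restrict Ω) :=
  ⟨by simpa using hΩ.measure_lt_top⟩

theorem memLp_restrict_of_continuous (hΩ : Bornology.IsBounded Ω) (hΩm : MeasurableSet Ω)
    {φ : E3 → ℝ} (hφ : Continuous φ) : MemLp φ 2 (volume.restrict Ω) := by
  have := isFiniteMeasure_restrict_of_isBounded hΩ
  obtain ⟨c, hc⟩ := hΩ.isCompact_closure.exists_bound_of_continuousOn hφ.continuousOn
  refine MemLp.of_bound hφ.aestronglyMeasurable c ?_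
  filter_upwards [ae_restrict_mem hΩm] with x hx using hc x (subset_closure hx)

theorem exists_isH2JetOf (hΩ : Bornology.IsBounded Ω) (hΩm : MeasurableSet Ω) {φ : E3 → ℝ}
    (hφ : ContDiff ℝ ∞ φ) : ∃ J : H2Jet Ω, IsH2JetOf φ J := by
  have h0 := memLp_restrict_of_continuous hΩ hΩm hφ.continuous
  have h1 (i) := memLp_restrict_of_continuous hΩ hΩm (continuous_pderiv hφ i)
  have h2 (i j) :=
    memLp_restrict_of_continuous hΩ hΩm (continuous_pderiv (contDiff_pderiv hφ j) i)
  refine ⟨WithLp.toLp 2 fun k => match k with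
    | none => h0.toLp
    | some (Sum.inl i) => (h1 i).toLp
    | some (Sum.inr (i, j)) => (h2 i j).toLp, h0.coeFn_toLp, fun i => (h1 i).coeFn_toLp,
      fun i j => (h2 i j).coeFn_toLp⟩

theorem smul_mem_H2Vanishing {Γ : Set E3} {J : H2Jet Ω} (c : ℝ) (hJ : J ∈ H2Vanishing Ω Γ) :
    c • J ∈ H2Vanishing Ω Γ := by
  refine map_mem_closure (continuous_const_smul c) hJ ?_
  rintro J ⟨φ, ⟨hφ, U, hU, hΓU, h0⟩, hJ0, hJ1, hJ2⟩
  have hp (i : Fin 3) {ψ : E3 → ℝ} (hψ : ContDiff ℝ ∞ ψ) (x : E3) :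
      pderiv i (fun x => c * ψ x) x = c * pderiv i ψ x := by
    rw [pderiv, fderiv_const_mul (hψ.differentiable (by simp)).differentiableAt]
    rfl
  refine ⟨fun x => c * φ x, ⟨contDiff_const.mul hφ, U, hU, hΓU, fun x hx => by simp [h0 x hx]⟩,
    ?_, fun i => ?_, fun i j => ?_⟩
  · filter_upwards [hJ0, Lp.coeFn_smul c (val₂ J)] with x h1 h2
    exact h2.trans (by simp [h1])
  · filter_upwards [hJ1 i, Lp.coeFn_smul c (grad₂ J i)] with x h1 h2
    exact h2.trans (by simp [h1, hp i hφ])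
  · filter_upwards [hJ2 i j, Lp.coeFn_smul c (hess₂ J i j)] with x h1 h2
    refine h2.trans ?_
    have : pderiv j (fun x => c * φ x) = fun x => c * pderiv j φ x := funext (hp j hφ)
    rw [this, hp i (contDiff_pderiv hφ j)]
    simp [h1]

theorem norm_le_of_ae_abs_le [IsFiniteMeasure (volume.restrict Ω)] {w : L2 Ω} {a : ℝ} (ha : 0 ≤ a)
    (h : ∀ᵐ x ∂(volume.restrict Ω), |w x| ≤ a) :
    ‖w‖ ≤ a * Real.sqrt ((volume.restrict Ω).real univ) := by
  refine (Lp.norm_le_of_ae_bound ha h).trans (le_of_eq ?_)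
  rw [mul_comm, Real.sqrt_eq_rpow]
  simp [measureUnivNNReal, Measure.real]
  exact Or.inl rfl

/-- Multiplication by a bounded function, as an operator on `L²(Ω)`. -/
theorem exists_mulOperator {ψ : L2 Ω} {a : ℝ} (hψ : ∀ᵐ x ∂(volume.restrict Ω), |ψ x| ≤ a) :
    ∃ P : L2 Ω →L[ℝ] L2 Ω, ∀ v, P v =ᵐ[volume.restrict Ω] fun x => ψ x * v x := by
  have hmem : MemLp ψ ∞ (volume.restrict Ω) :=
    memLp_top_of_bound (Lp.aestronglyMeasurable ψ) a hψ
  refine ⟨(ContinuousLinearMap.mul ℝ ℝ).holderL (volume.restrict Ω) ∞ 2 2 hmem.toLp, fun v => ?_⟩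
  filter_upwards [(ContinuousLinearMap.mul ℝ ℝ).coeFn_holder (r := 2) hmem.toLp v,
    hmem.coeFn_toLp] with x h1 h2
  exact h1.trans (by simp [h2])

end Jets

/-! ### The increments of the concentration, tested against smooth functions -/

namespace Data

variable {D : Data}

theorem Admissible.continuousOn_height (hD : D.Admissible) : ContinuousOn D.d (closure D.G) :=
  let ⟨_, h⟩ := hD.lipschitz_height
  h.continuousOn

theorem Admissible.isOpen_dom (hD : D.Admissible) : IsOpen D.dom :=
  isOpen_domain hD.lipschitz_base.isOpen hD.continuousOn_height

theorem Admissible.isBounded_dom (hD : D.Admissible) : Bornology.IsBounded D.dom :=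
  isBounded_domain hD.lipschitz_base.isBounded hD.continuousOn_height

theorem Admissible.coversUpperBdry (hD : D.Admissible) :
    CoversUpperBdry D.dom (aboveBdry D.G D.d) := fun _ hx hx' h2 =>
  mem_aboveBdry_of_mem_closure hD.lipschitz_base.isOpen hD.continuousOn_height hx hx' h2

theorem dom_subset_upperHalf (D : Data) : D.dom ⊆ upperHalf := fun _ hx => hx.2.1

/-- The bound, up to a constant, for the time derivative of the concentration tested against
functions with bounded gradient. -/
noncomputable def rate (D : Data) (S : ℝ → L2 D.dom) (u : ℝ → Fin 3 → H1Jet D.dom)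
    (C : ℝ → H1Jet D.dom) (t : ℝ) : ℝ :=
  (∑ i, ‖val (u t i)‖) * ‖val (C t)‖ + ‖C t‖ + ‖S t‖

theorem rate_nonneg (S : ℝ → L2 D.dom) (u : ℝ → Fin 3 → H1Jet D.dom) (C : ℝ → H1Jet D.dom)
    (t : ℝ) : 0 ≤ D.rate S u C t := by
  have := Finset.sum_nonneg fun i (_ : i ∈ Finset.univ) => norm_nonneg (val (u t i))
  unfold rate
  positivity

theorem IsWeakSolution.memLp_rate {ε : ℝ} {S : ℝ → L2 D.dom} {u : ℝ → Fin 3 → H1Jet D.dom}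
    {C : ℝ → H1Jet D.dom} (h : D.IsWeakSolution ε S u C) (hS : MemLp S 2 (timeMeasure D.T)) :
    MemLp (D.rate S u C) 2 (timeMeasure D.T) := by
  have h1 : MemLp (fun t => ∑ i, ‖val (u t i)‖) 2 (timeMeasure D.T) :=
    memLp_finsetSum _ fun i _ => (memLp_val (memLp_component h.velocity_memLp i)).norm
  have h2 : MemLp (fun t => (∑ i, ‖val (u t i)‖) * ‖val (C t)‖) 2 (timeMeasure D.T) :=
    h.conc_bounded.norm.mul h1
  exact (h2.add h.conc_memLp.norm).add hS.norm

/-- The right-hand side of the concentration equation, tested against `Ψ`. -/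
noncomputable def concRhs (D : Data) (S : ℝ → L2 D.dom) (u : ℝ → Fin 3 → H1Jet D.dom)
    (C : ℝ → H1Jet D.dom) (Ψ : H2Jet D.dom) (t : ℝ) : ℝ :=
  (∫ x in D.dom, ∑ i, val (u t i) x * val (C t) x * grad₂ Ψ i x)
    - D.diffForm (grad (C t)) (grad₂ Ψ) + inner ℝ (S t) (val₂ Ψ)

theorem transport_eq_sum_inner {P : Fin 3 → L2 D.dom →L[ℝ] L2 D.dom} {Ψ : H2Jet D.dom}
    (hP : ∀ i v, P i v =ᵐ[volume.restrict D.dom] fun x => grad₂ Ψ i x * v x)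
    (u : Fin 3 → H1Jet D.dom) (C : H1Jet D.dom) :
    ∫ x in D.dom, ∑ i, val (u i) x * val C x * grad₂ Ψ i x =
      ∑ i, inner ℝ (val (u i)) (P i (val C)) := by
  simp only [L2.inner_def]
  rw [← integral_finsetSum _ fun i _ => L2.integrable_inner _ _]
  refine integral_congr_ae ?_
  have h : ∀ᵐ x ∂(volume.restrict D.dom), ∀ i, P i (val C) x = grad₂ Ψ i x * val C x :=
    ae_all_iff.2 fun i => hP i _
  filter_upwards [h] with x hx
  refine Finset.sum_congr rfl fun i _ => ?_
  rw [hx i]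
  simp
  ring

/-- The velocity, the concentration and the source enter the tested concentration equation only
through `rate` when the test function and its gradient are bounded. -/
theorem Admissible.exists_abs_concRhs_le (hD : D.Admissible) :
    ∃ K : ℝ, 0 < K ∧ ∀ (S : ℝ → L2 D.dom) (u : ℝ → Fin 3 → H1Jet D.dom) (C : ℝ → H1Jet D.dom)
      (Ψ : H2Jet D.dom) (a : ℝ), 0 ≤ a →
      (∀ᵐ x ∂(volume.restrict D.dom), |val₂ Ψ x| ≤ a) →
      (∀ i, ∀ᵐ x ∂(volume.restrict D.dom), |grad₂ Ψ i x| ≤ a) →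
      ∀ t, |D.concRhs S u C Ψ t| ≤ a * (K * D.rate S u C t) := by
  have hfin := isFiniteMeasure_restrict_of_isBounded hD.isBounded_dom
  set κ := Real.sqrt ((volume.restrict D.dom).real univ) with hκ
  have hκ0 : 0 ≤ κ := Real.sqrt_nonneg _
  set m := ∑ i, ∑ j, |D.M i j| with hm
  have hm0 : 0 ≤ m := Finset.sum_nonneg fun i _ => Finset.sum_nonneg fun j _ => abs_nonneg _
  refine ⟨1 + m * κ + κ, by positivity, fun S u C Ψ a ha h0 h1 t => ?_⟩
  choose P hP using fun i => exists_mulOperator (h1 i)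
  have e1 : |∫ x in D.dom, ∑ i, val (u t i) x * val (C t) x * grad₂ Ψ i x| ≤
      a * ((∑ i, ‖val (u t i)‖) * ‖val (C t)‖) := by
    rw [transport_eq_sum_inner hP]
    refine (Finset.abs_sum_le_sum_abs _ _).trans ?_
    rw [Finset.sum_mul, Finset.mul_sum]
    refine Finset.sum_le_sum fun i _ => (abs_real_inner_le_norm _ _).trans ?_
    have : ‖P i (val (C t))‖ ≤ a * ‖val (C t)‖ := by
      refine Lp.norm_le_mul_norm_of_ae_le_mul ?_
      filter_upwards [hP i (val (C t)), h1 i] with x h2 h3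
      rw [h2, norm_mul]
      exact mul_le_mul_of_nonneg_right h3 (norm_nonneg _)
    calc ‖val (u t i)‖ * ‖P i (val (C t))‖ ≤ ‖val (u t i)‖ * (a * ‖val (C t)‖) := by gcongr
      _ = a * (‖val (u t i)‖ * ‖val (C t)‖) := by ring
  have e2 : |D.diffForm (grad (C t)) (grad₂ Ψ)| ≤ a * (m * κ * ‖C t‖) := by
    have : a * (m * κ * ‖C t‖) = ∑ i, ∑ j, |D.M i j| * (‖C t‖ * (a * κ)) := by
      simp only [hm, Finset.sum_mul, Finset.mul_sum]
      exact Finset.sum_congr rfl fun i _ => Finset.sum_congr rfl fun j _ => by ring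
    rw [this, diffForm]
    refine (Finset.abs_sum_le_sum_abs _ _).trans (Finset.sum_le_sum fun i _ => ?_)
    refine (Finset.abs_sum_le_sum_abs _ _).trans (Finset.sum_le_sum fun j _ => ?_)
    rw [abs_mul]
    gcongr
    refine (abs_real_inner_le_norm _ _).trans ?_
    gcongr
    · exact norm_grad_le _ _
    · exact norm_le_of_ae_abs_le ha (h1 i)
  have e3 : |inner ℝ (S t) (val₂ Ψ)| ≤ a * (κ * ‖S t‖) := by
    refine (abs_real_inner_le_norm _ _).trans ?_
    calc ‖S t‖ * ‖val₂ Ψ‖ ≤ ‖S t‖ * (a * κ) := by gcongr; exact norm_le_of_ae_abs_le ha h0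
      _ = _ := by ring
  have e4 : |D.concRhs S u C Ψ t| ≤ a * ((∑ i, ‖val (u t i)‖) * ‖val (C t)‖) +
      a * (m * κ * ‖C t‖) + a * (κ * ‖S t‖) := by
    unfold concRhs
    refine (abs_add_le _ _).trans (add_le_add ((abs_sub _ _).trans (add_le_add e1 e2)) e3)
  refine e4.trans ?_
  rw [← mul_add, ← mul_add]
  refine mul_le_mul_of_nonneg_left ?_ ha
  have hs := Finset.sum_nonneg fun i (_ : i ∈ Finset.univ) => norm_nonneg (val (u t i))
  unfold rate
  have p1 : 0 ≤ (∑ i, ‖val (u t i)‖) * ‖val (C t)‖ := by positivity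
  have p2 := norm_nonneg (C t)
  have p3 := norm_nonneg (S t)
  have p4 : 0 ≤ m * κ := by positivity
  nlinarith [mul_nonneg p4 p1, mul_nonneg p4 p3, mul_nonneg hκ0 p1, mul_nonneg hκ0 p2]

theorem IsWeakSolution.integrable_transport {ε : ℝ} {S : ℝ → L2 D.dom}
    {u : ℝ → Fin 3 → H1Jet D.dom} {C : ℝ → H1Jet D.dom} (h : D.IsWeakSolution ε S u C)
    {Ψ : H2Jet D.dom} {a : ℝ} (h1 : ∀ i, ∀ᵐ x ∂(volume.restrict D.dom), |grad₂ Ψ i x| ≤ a) :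
    Integrable (fun t => ∫ x in D.dom, ∑ i, val (u t i) x * val (C t) x * grad₂ Ψ i x)
      (timeMeasure D.T) := by
  choose P hP using fun i => exists_mulOperator (h1 i)
  simp only [transport_eq_sum_inner hP]
  exact integrable_finsetSum _ fun i _ => integrable_inner_of_memLp
    (memLp_val (memLp_component h.velocity_memLp i)) ((P i).comp_memLp' (memLp_val h.conc_memLp))

theorem IsWeakSolution.integrable_diffForm {ε : ℝ} {S : ℝ → L2 D.dom}
    {u : ℝ → Fin 3 → H1Jet D.dom} {C : ℝ → H1Jet D.dom} (h : D.IsWeakSolution ε S u C)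
    (Ψ : H2Jet D.dom) :
    Integrable (fun t => D.diffForm (grad (C t)) (grad₂ Ψ)) (timeMeasure D.T) :=
  integrable_finsetSum _ fun _ _ => integrable_finsetSum _ fun j _ =>
    (integrable_inner_of_memLp (memLp_grad h.conc_memLp j) (memLp_const _)).const_mul _

theorem diffForm_smul_right (p q : Fin 3 → L2 D.dom) (c : ℝ) :
    D.diffForm p (fun i => c • q i) = c * D.diffForm p q := by
  simp only [diffForm, Finset.mul_sum, real_inner_smul_right]
  exact Finset.sum_congr rfl fun i _ => Finset.sum_congr rfl fun j _ => by ring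

theorem transport_smul (u : Fin 3 → H1Jet D.dom) (C : H1Jet D.dom) (q : Fin 3 → L2 D.dom) (c : ℝ) :
    ∫ x in D.dom, ∑ i, val (u i) x * val C x * (c • q i : L2 D.dom) x =
      c * ∫ x in D.dom, ∑ i, val (u i) x * val C x * q i x := by
  rw [← integral_const_mul]
  refine integral_congr_ae ?_
  have h : ∀ᵐ x ∂(volume.restrict D.dom), ∀ i, (c • q i : L2 D.dom) x = c * q i x :=
    ae_all_iff.2 fun i => Lp.coeFn_smul c (q i)
  filter_upwards [h] with x hx
  rw [Finset.mul_sum]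
  refine Finset.sum_congr rfl fun i _ => ?_
  rw [hx i]
  ring

/-- A smooth function in space, multiplied by a Lipschitz function of time that vanishes at the
final time, is an admissible test function for the concentration. -/
theorem isH1InTime_hatFunction {A : Set ℝ} (hA : MeasurableSet A) {Ψ : H2Jet D.dom}
    (hΨ : Ψ ∈ D.H2A) :
    IsH1InTime D.T D.H2A (fun t => hatFunction D.T A t • Ψ)
      (fun t => (A.indicator 1 t : ℝ) • Ψ) := by
  have hloc : ∀ a b : ℝ, IntervalIntegrable (A.indicator (1 : ℝ → ℝ)) volume a b := fun a b =>
    ⟨(integrable_const (1 : ℝ)).indicator hA, (integrable_const (1 : ℝ)).indicator hA⟩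
  refine ⟨?_, Eventually.of_forall fun t => smul_mem_H2Vanishing _ hΨ,
    fun t _ => smul_mem_H2Vanishing _ hΨ, fun t _ => ?_⟩
  · have h1 : MemLp (A.indicator fun _ => Ψ) 2 (timeMeasure D.T) :=
      (memLp_const Ψ).indicator hA
    refine h1.congr_norm ?_ (Eventually.of_forall fun t => ?_)
    · refine h1.1.congr (Eventually.of_forall fun t => ?_)
      by_cases ht : t ∈ A <;> simp [ht]
    · by_cases ht : t ∈ A <;> simp [ht]
  · rw [intervalIntegral.integral_smul_const, ← add_smul, hatFunction, hatFunction,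
      ← intervalIntegral.integral_add_adjacent_intervals (hloc 0 t) (hloc t D.T)]
    congr 1
    ring

/-- The concentration equation, integrated in time against a fixed smooth test function. -/
theorem IsWeakSolution.ae_inner_conc_eq {ε : ℝ} {S : ℝ → L2 D.dom}
    {u : ℝ → Fin 3 → H1Jet D.dom} {C : ℝ → H1Jet D.dom} (h : D.IsWeakSolution ε S u C)
    (hT : 0 < D.T) (hS : MemLp S 2 (timeMeasure D.T)) {Ψ : H2Jet D.dom} (hΨ : Ψ ∈ D.H2A)
    {a : ℝ} (h1 : ∀ i, ∀ᵐ x ∂(volume.restrict D.dom), |grad₂ Ψ i x| ≤ a) :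
    Integrable (D.concRhs S u C Ψ) (timeMeasure D.T) ∧
    ∀ᵐ t ∂(timeMeasure D.T), (inner ℝ (val (C t)) (val₂ Ψ) : ℝ) =
      inner ℝ D.C₀ (val₂ Ψ) + ∫ s in (0 : ℝ)..t, D.concRhs S u C Ψ s := by
  have i1 := h.integrable_transport h1
  have i2 := h.integrable_diffForm Ψ
  have i3 : Integrable (fun t => (inner ℝ (S t) (val₂ Ψ) : ℝ)) (timeMeasure D.T) :=
    integrable_inner_of_memLp hS (memLp_const _)
  have i4 : Integrable (fun t => (inner ℝ (val (C t)) (val₂ Ψ) : ℝ)) (timeMeasure D.T) :=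
    integrable_inner_of_memLp (memLp_val h.conc_memLp) (memLp_const _)
  have hF : Integrable (D.concRhs S u C Ψ) (timeMeasure D.T) := (i1.sub i2).add i3
  refine ⟨hF, ae_eq_add_integral_of_weak hT.le i4 hF fun A hA => ?_⟩
  have key := h.concentration _ _ (isH1InTime_hatFunction hA hΨ) (by simp [hatFunction])
  set χ := hatFunction D.T A with hχ
  have hχc : Continuous χ := continuous_hatFunction D.T hA
  obtain ⟨c, hc⟩ := isCompact_Icc.exists_bound_of_continuousOn (s := Icc 0 D.T) hχc.continuousOn
  have hχmul {f : ℝ → ℝ} (hf : Integrable f (timeMeasure D.T)) :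
      Integrable (fun t => χ t * f t) (timeMeasure D.T) := by
    refine hf.bdd_mul hχc.aestronglyMeasurable (c := c) ?_
    filter_upwards [ae_timeMeasure_mem D.T] with t ht using hc t (Ioo_subset_Icc_self ht)
  have hAmul {f : ℝ → ℝ} (hf : Integrable f (timeMeasure D.T)) :
      Integrable (fun t => A.indicator 1 t * f t) (timeMeasure D.T) := by
    refine (hf.indicator hA).congr (Eventually.of_forall fun t => ?_)
    by_cases ht : t ∈ A <;> simp [ht]
  have g1 (c : ℝ) : val₂ (c • Ψ) = c • val₂ Ψ := rfl
  have g2 (c : ℝ) (i : Fin 3) : grad₂ (c • Ψ) i = c • grad₂ Ψ i := rfl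
  have g3 (c : ℝ) : grad₂ (c • Ψ) = fun i => c • grad₂ Ψ i := rfl
  simp only [ConcentrationIdentity, intervalIntegral_eq_integral_timeMeasure hT.le, g1, g2, g3,
    real_inner_smul_right, transport_smul, diffForm_smul_right] at key
  have j1 : Integrable (fun t => -(A.indicator 1 t * (inner ℝ (val (C t)) (val₂ Ψ) : ℝ)))
      (timeMeasure D.T) := (hAmul i4).neg
  have j2 : Integrable (fun t => -(A.indicator 1 t * (inner ℝ (val (C t)) (val₂ Ψ) : ℝ)) -
      χ t * ∫ x in D.dom, ∑ i, val (u t i) x * val (C t) x * grad₂ Ψ i x) (timeMeasure D.T) :=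
    j1.sub (hχmul i1)
  have j3 : Integrable (fun t => χ t * (∫ x in D.dom, ∑ i,
      val (u t i) x * val (C t) x * grad₂ Ψ i x) - χ t * D.diffForm (grad (C t)) (grad₂ Ψ))
      (timeMeasure D.T) := (hχmul i1).sub (hχmul i2)
  rw [integral_add j2 (hχmul i2), integral_sub j1 (hχmul i1), integral_neg] at key
  have e : ∫ t, χ t * D.concRhs S u C Ψ t ∂(timeMeasure D.T) =
      (∫ t, χ t * (∫ x in D.dom, ∑ i, val (u t i) x * val (C t) x * grad₂ Ψ i x)
        ∂(timeMeasure D.T)) - (∫ t, χ t * D.diffForm (grad (C t)) (grad₂ Ψ) ∂(timeMeasure D.T))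
        + ∫ t, χ t * inner ℝ (S t) (val₂ Ψ) ∂(timeMeasure D.T) := by
    simp only [concRhs, mul_add, mul_sub]
    rw [integral_add j3 (hχmul i3),
      integral_sub (hχmul i1) (hχmul i2)]
  rw [e]
  linarith

/-- Increments of the concentration, tested against a smooth function that vanishes near `Γ_A`. -/
theorem Admissible.exists_increment_bound (hD : D.Admissible) :
    ∃ K : ℝ, 0 < K ∧ ∀ (ε : ℝ) (S : ℝ → L2 D.dom) (u : ℝ → Fin 3 → H1Jet D.dom)
      (C : ℝ → H1Jet D.dom), D.IsWeakSolution ε S u C → MemLp S 2 (timeMeasure D.T) →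
      ∀ h : ℝ, 0 < h → h < D.T →
      ∀ (φ : E3 → ℝ) (a : ℝ), 0 ≤ a → IsSmoothVanishingNear D.dom (aboveBdry D.G D.d) φ →
      (∀ x, |φ x| ≤ a) → (∀ i x, |pderiv i φ x| ≤ a) →
      ∃ ψ : L2 D.dom, ψ =ᵐ[volume.restrict D.dom] φ ∧ ∀ᵐ t ∂(timeMeasure (D.T - h)),
        |inner ℝ (val (C (t + h)) - val (C t)) ψ| ≤
          a * ∫ s in t..(t + h), K * D.rate S u C s := by
  obtain ⟨K, hK, hbound⟩ := hD.exists_abs_concRhs_le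
  refine ⟨K, hK, fun ε S u C hsol hS h h0 hT φ a ha hφ hφ0 hφ1 => ?_⟩
  obtain ⟨Ψ, hΨ⟩ := exists_isH2JetOf hD.isBounded_dom hD.isOpen_dom.measurableSet hφ.1
  have hΨA : Ψ ∈ D.H2A := subset_closure ⟨φ, hφ, hΨ⟩
  have b0 : ∀ᵐ x ∂(volume.restrict D.dom), |val₂ Ψ x| ≤ a := by
    filter_upwards [hΨ.1] with x hx
    rw [hx]
    exact hφ0 x
  have b1 (i : Fin 3) : ∀ᵐ x ∂(volume.restrict D.dom), |grad₂ Ψ i x| ≤ a := by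
    filter_upwards [hΨ.2.1 i] with x hx
    rw [hx]
    exact hφ1 i x
  obtain ⟨hF, hrep⟩ := hsol.ae_inner_conc_eq hD.time_pos hS hΨA b1
  refine ⟨val₂ Ψ, hΨ.1, ?_⟩
  filter_upwards [ae_timeMeasure_mono (by linarith) hrep, ae_timeMeasure_shift h0.le hrep,
    ae_timeMeasure_mem (D.T - h)] with t r1 r2 ht
  have hrate : Integrable (D.rate S u C) (timeMeasure D.T) :=
    (hsol.memLp_rate hS).integrable one_le_two
  have ht2 : t + h ≤ D.T := by linarith [ht.2]
  rw [inner_sub_left, r1, r2, add_sub_add_left_eq_sub,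
    intervalIntegral.integral_interval_sub_left
      (intervalIntegrable_of_timeMeasure hF le_rfl (by linarith [ht.1]) ht2)
      (intervalIntegrable_of_timeMeasure hF le_rfl ht.1.le (by linarith [ht.2])),
    ← intervalIntegral.integral_const_mul]
  refine intervalIntegral.abs_integral_le_integral_abs (by linarith) |>.trans ?_
  refine intervalIntegral.integral_mono (by linarith)
    (intervalIntegrable_of_timeMeasure hF ht.1.le (by linarith) ht2).abs
    (intervalIntegrable_of_timeMeasure ((hrate.const_mul K).const_mul a) ht.1.le (by linarith) ht2)
    fun s => hbound S u C Ψ a ha b0 b1 s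

end Data

/-! ### Uniform bounds from the energy inequality -/

theorem ofReal_norm_sq {F : Type*} [NormedAddCommGroup F] (x : F) :
    ENNReal.ofReal (‖x‖ ^ 2) = ‖x‖ₑ ^ 2 := by
  rw [ENNReal.ofReal_pow (norm_nonneg _), ofReal_norm]

theorem eLpNorm_two_sq_eq_ofReal_integral {α F : Type*} [MeasurableSpace α]
    [NormedAddCommGroup F] {μ : Measure α} {f : α → F} (hf : MemLp f 2 μ) :
    eLpNorm f 2 μ ^ 2 = ENNReal.ofReal (∫ t, ‖f t‖ ^ 2 ∂μ) := by
  have hi : Integrable (fun t => ‖f t‖ ^ 2) μ := hf.norm.integrable_sq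
  rw [eLpNorm_two_sq, ofReal_integral_eq_lintegral_ofReal hi
    (Eventually.of_forall fun _ => sq_nonneg _)]
  simp only [ofReal_norm_sq]

theorem eLpNorm_two_le_ofReal_iff {α F : Type*} [MeasurableSpace α]
    [NormedAddCommGroup F] {μ : Measure α} {f : α → F} (hf : MemLp f 2 μ) {R : ℝ} (hR : 0 ≤ R) :
    eLpNorm f 2 μ ≤ ENNReal.ofReal R ↔ ∫ t, ‖f t‖ ^ 2 ∂μ ≤ R ^ 2 := by
  rw [← ENNReal.pow_le_pow_left_iff two_ne_zero, eLpNorm_two_sq_eq_ofReal_integral hf,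
    ← ENNReal.ofReal_pow hR, ENNReal.ofReal_le_ofReal_iff (sq_nonneg R)]

/-- A bound on the integral over `(0, t)` for almost every `t < T` holds over `(0, T)`. -/
theorem integral_le_of_ae_intervalIntegral_le {T R : ℝ} (hT : 0 < T) {N : ℝ → ℝ}
    (hN : ∀ t, 0 ≤ N t) (hi : Integrable N (timeMeasure T))
    (h : ∀ᵐ t ∂(timeMeasure T), ∫ s in (0 : ℝ)..t, N s ≤ R) :
    ∫ t, N t ∂(timeMeasure T) ≤ R := by
  have hii := (integrable_timeMeasure_iff_intervalIntegrable hT.le).1 hi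
  rw [← intervalIntegral_eq_integral_timeMeasure hT.le]
  have hle : ∀ τ ∈ Ioo 0 T, ∫ s in (0 : ℝ)..τ, N s ≤ R := by
    intro τ hτ
    have h' : ∀ᵐ t ∂(volume.restrict (Ioo τ T)), ∫ s in (0 : ℝ)..t, N s ≤ R :=
      ae_mono (Measure.restrict_mono_set _ (Ioo_subset_Ioo_left hτ.1.le)) h
    have : NeBot (ae (volume.restrict (Ioo τ T))) := by
      rw [ae_neBot, Ne, Measure.restrict_eq_zero, Real.volume_Ioo]
      simpa using hτ.2
    obtain ⟨t, ht, htm⟩ := (h'.and (ae_restrict_mem measurableSet_Ioo)).exists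
    refine le_trans ?_ ht
    exact intervalIntegral.integral_mono_interval le_rfl hτ.1.le htm.1.le
      (Eventually.of_forall hN)
      (intervalIntegrable_of_timeMeasure hi le_rfl (hτ.1.le.trans htm.1.le) htm.2.le)
  have hcont := intervalIntegral.continuousOn_primitive_interval' hii left_mem_uIcc
  rw [uIcc_of_le hT.le] at hcont
  have hmem : T ∈ closure (Ioo 0 T) := by
    rw [closure_Ioo hT.ne]
    exact right_mem_Icc.2 hT.le
  have := ((hcont T (right_mem_Icc.2 hT.le)).mono Ioo_subset_Icc_self).mem_closure hmem
    (t := Iic R) hle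
  simpa using this

theorem norm_sq_jet {Ω : Set E3} (J : H1Jet Ω) :
    ‖J‖ ^ 2 = ‖val J‖ ^ 2 + ∑ i, ‖grad J i‖ ^ 2 := by
  rw [PiLp.norm_sq_eq_of_L2, Fintype.sum_option]
  rfl

theorem mul_le_sq_div_add {q : ℝ} (hq : 0 < q) (a b : ℝ) :
    a * b ≤ 1 / q * a ^ 2 + q / 4 * b ^ 2 := by
  have h : 1 / q * a ^ 2 + q / 4 * b ^ 2 - a * b = 1 / q * (a - q / 2 * b) ^ 2 := by
    field_simp
    ring
  have : 0 ≤ 1 / q * (a - q / 2 * b) ^ 2 := by positivity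
  linarith

theorem H1Zero_subset_H1Vanishing {Ω Γ : Set E3} (h : Disjoint Ω Γ) :
    H1Zero Ω ⊆ H1Vanishing Ω Γ := by
  refine closure_mono ?_
  rintro J ⟨φ, hφ, hJ⟩
  refine ⟨φ, ⟨hφ.1, (tsupport φ)ᶜ, (isClosed_tsupport φ).isOpen_compl, fun x hx hx' => ?_,
    fun x hx => image_eq_zero_of_notMem_tsupport hx.1⟩, hJ⟩
  exact Set.disjoint_left.1 h (hφ.2.2 hx') hx

namespace Data

variable {D : Data}

/-- Poincaré's inequality in the vertical direction. -/
theorem Admissible.exists_poincare (hD : D.Admissible) :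
    ∃ L : ℝ, 0 < L ∧ ∀ J ∈ D.H1A, ‖val J‖ ≤ L * ‖grad J 2‖ := by
  obtain ⟨L, hL, hLd⟩ := exists_height_bound hD.lipschitz_base.isBounded hD.continuousOn_height
  refine ⟨L, hL, fun J hJ => ?_⟩
  refine (norm_val_le_of_exit hD.isOpen_dom hD.coversUpperBdry D.dom_subset_upperHalf
    (v := L • vert) (by simpa using hL.le) (fun x hx hx' => ?_) hJ).trans (le_of_eq ?_)
  · have h1 := hx'.2.2.trans_le (hLd _ (subset_closure hx'.1))
    have h2 := hx.2.1
    simp at h1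
    linarith
  · rw [dirGrad, Fin.sum_univ_three]
    simp [vert, norm_smul, abs_of_pos hL]

theorem diffForm_coercive {l : ℝ}
    (hl : ∀ ξ : Fin 3 → ℝ, l * ∑ i, ξ i ^ 2 ≤ ∑ i, ∑ j, D.M i j * ξ j * ξ i)
    (p : Fin 3 → L2 D.dom) : l * ∑ i, ‖p i‖ ^ 2 ≤ D.diffForm p p := by
  have hint (i j) : Integrable (fun x => (inner ℝ (p j x) (p i x) : ℝ))
      (volume.restrict D.dom) := L2.integrable_inner _ _
  have e1 : l * ∑ i, ‖p i‖ ^ 2 = ∫ x in D.dom, l * ∑ i, inner ℝ (p i x) (p i x) := by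
    rw [integral_const_mul, integral_finsetSum _ fun i _ => hint i i]
    congr 1
    refine Finset.sum_congr rfl fun i _ => ?_
    rw [← real_inner_self_eq_norm_sq, L2.inner_def]
  have e2 (m : Fin 3 → Fin 3 → ℝ) : ∑ i, ∑ j, m i j * inner ℝ (p j) (p i) =
      ∫ x in D.dom, ∑ i, ∑ j, m i j * inner ℝ (p j x) (p i x) := by
    rw [integral_finsetSum _ fun i _ => integrable_finsetSum _ fun j _ => (hint i j).const_mul _]
    refine Finset.sum_congr rfl fun i _ => ?_
    rw [integral_finsetSum _ fun j _ => (hint i j).const_mul _]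
    refine Finset.sum_congr rfl fun j _ => ?_
    rw [integral_const_mul, L2.inner_def]
  rw [e1, diffForm, e2 fun i j => D.M i j]
  refine integral_mono ((integrable_finsetSum _ fun i _ => hint i i).const_mul _)
    (integrable_finsetSum _ fun i _ => integrable_finsetSum _ fun j _ =>
      (hint i j).const_mul _) fun x => ?_
  refine le_of_eq_of_le ?_ ((hl fun i => p i x).trans_eq ?_)
  · simp [pow_two]
  · refine Finset.sum_congr rfl fun i _ => Finset.sum_congr rfl fun j _ => ?_
    simp only [RCLike.inner_apply, conj_trivial]
    ring

/-- The sum of the squares of the `H¹` norms of the horizontal velocity and of the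
concentration. -/
noncomputable def horizSq (D : Data) (u : ℝ → Fin 3 → H1Jet D.dom) (C : ℝ → H1Jet D.dom)
    (t : ℝ) : ℝ :=
  ‖u t 0‖ ^ 2 + ‖u t 1‖ ^ 2 + ‖C t‖ ^ 2

theorem horizSq_nonneg (u : ℝ → Fin 3 → H1Jet D.dom) (C : ℝ → H1Jet D.dom) (t : ℝ) :
    0 ≤ D.horizSq u C t := by
  unfold horizSq
  positivity

/-- The dissipation rate in the energy inequality. -/
noncomputable def dissipation (D : Data) (ε : ℝ) (u : ℝ → Fin 3 → H1Jet D.dom)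
    (C : ℝ → H1Jet D.dom) (s : ℝ) : ℝ :=
  (∑ j : Fin 2, D.viscForm (u s j.castSucc) (u s j.castSucc))
    + ε ^ 2 * D.viscForm (u s 2) (u s 2) + D.diffForm (grad (C s)) (grad (C s))

theorem Admissible.exists_dissipation_ge (hD : D.Admissible) :
    ∃ q : ℝ, 0 < q ∧ ∀ (ε : ℝ) (u : ℝ → Fin 3 → H1Jet D.dom) (C : ℝ → H1Jet D.dom) (t : ℝ),
      u t ∈ D.V → C t ∈ D.H1A → q * D.horizSq u C t ≤ D.dissipation ε u C t := by
  obtain ⟨L, hL, hpoin⟩ := hD.exists_poincare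
  obtain ⟨l, hl, hcoer⟩ := hD.coercive
  obtain ⟨m, hm, hmν⟩ : ∃ m : ℝ, 0 < m ∧ ∀ i, m ≤ D.ν i := by
    refine ⟨min (D.ν 0) (min (D.ν 1) (D.ν 2)), ?_, fun i => ?_⟩
    · exact lt_min (hD.visc_pos 0) (lt_min (hD.visc_pos 1) (hD.visc_pos 2))
    · fin_cases i <;> simp
  have hjet {J : H1Jet D.dom} (hJ : J ∈ D.H1A) :
      ‖J‖ ^ 2 ≤ (1 + L ^ 2) * ∑ i, ‖grad J i‖ ^ 2 := by
    have h1 : ‖val J‖ ^ 2 ≤ (L * ‖grad J 2‖) ^ 2 :=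
      pow_le_pow_left₀ (norm_nonneg _) (hpoin J hJ) 2
    have h2 : ‖grad J 2‖ ^ 2 ≤ ∑ i, ‖grad J i‖ ^ 2 :=
      Finset.single_le_sum (f := fun i => ‖grad J i‖ ^ 2) (fun i _ => sq_nonneg _)
        (Finset.mem_univ 2)
    rw [norm_sq_jet]
    nlinarith [mul_le_mul_of_nonneg_left h2 (sq_nonneg L)]
  have hvisc (J : H1Jet D.dom) : m * ∑ i, ‖grad J i‖ ^ 2 ≤ D.viscForm J J := by
    rw [viscForm, Finset.mul_sum]
    refine Finset.sum_le_sum fun i _ => ?_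
    rw [real_inner_self_eq_norm_sq]
    exact mul_le_mul_of_nonneg_right (hmν i) (sq_nonneg _)
  have hgrad (J : H1Jet D.dom) : 0 ≤ ∑ i, ‖grad J i‖ ^ 2 :=
    Finset.sum_nonneg fun i _ => sq_nonneg _
  refine ⟨min m l / (1 + L ^ 2), by positivity, fun ε u C t hu hC => ?_⟩
  set q := min m l / (1 + L ^ 2) with hq
  have hq0 : 0 < q := by positivity
  have hqL : q * (1 + L ^ 2) = min m l := div_mul_cancel₀ _ (by positivity)
  have key {J : H1Jet D.dom} (hJ : J ∈ D.H1A) {k : ℝ} (hk : min m l ≤ k) :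
      q * ‖J‖ ^ 2 ≤ k * ∑ i, ‖grad J i‖ ^ 2 :=
    calc q * ‖J‖ ^ 2 ≤ q * ((1 + L ^ 2) * ∑ i, ‖grad J i‖ ^ 2) := by gcongr; exact hjet hJ
      _ = min m l * ∑ i, ‖grad J i‖ ^ 2 := by rw [← mul_assoc, hqL]
      _ ≤ _ := mul_le_mul_of_nonneg_right hk (hgrad J)
  have k0 := (key hu.1 (min_le_left m l)).trans (hvisc _)
  have k1 := (key hu.2.1 (min_le_left m l)).trans (hvisc _)
  have k2 := (key hC (min_le_right m l)).trans (diffForm_coercive hcoer _)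
  have k3 : 0 ≤ ε ^ 2 * D.viscForm (u t 2) (u t 2) :=
    mul_nonneg (sq_nonneg _) ((mul_nonneg hm.le (hgrad _)).trans (hvisc _))
  simp only [dissipation, horizSq, Fin.sum_univ_two, mul_add]
  exact add_le_add (le_add_of_le_of_nonneg (add_le_add k0 k1) k3) k2

/-- The vertical velocity is controlled by the horizontal one, because the field is divergence
free and the vertical velocity vanishes on the boundary. -/
theorem Admissible.exists_velocity_le (hD : D.Admissible) :
    ∃ c : ℝ, 0 < c ∧ ∀ v ∈ D.V, (∑ i, ‖val (v i)‖) ^ 2 ≤ c * (‖v 0‖ ^ 2 + ‖v 1‖ ^ 2) := by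
  obtain ⟨L, hL, hpoin⟩ := hD.exists_poincare
  refine ⟨2 * (1 + L) ^ 2, by positivity, fun v hv => ?_⟩
  have h2 : v 2 ∈ D.H1A :=
    H1Zero_subset_H1Vanishing (disjoint_domain_aboveBdry hD.lipschitz_base.isOpen) hv.2.2.1
  have hdiv : grad (v 2) 2 = -(grad (v 0) 0 + grad (v 1) 1) := by
    have := hv.2.2.2
    rw [Fin.sum_univ_three] at this
    rw [eq_neg_iff_add_eq_zero, add_comm]
    exact this
  have e2 : ‖val (v 2)‖ ≤ L * (‖v 0‖ + ‖v 1‖) := by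
    refine (hpoin _ h2).trans ?_
    rw [hdiv, norm_neg]
    gcongr
    exact (norm_add_le _ _).trans (add_le_add (norm_grad_le _ _) (norm_grad_le _ _))
  have e : ∑ i, ‖val (v i)‖ ≤ (1 + L) * (‖v 0‖ + ‖v 1‖) := by
    rw [Fin.sum_univ_three]
    have e0 := norm_val_le (v 0)
    have e1 := norm_val_le (v 1)
    linarith
  have hs := Finset.sum_nonneg fun i (_ : i ∈ Finset.univ) => norm_nonneg (val (v i))
  calc (∑ i, ‖val (v i)‖) ^ 2 ≤ ((1 + L) * (‖v 0‖ + ‖v 1‖)) ^ 2 := pow_le_pow_left₀ hs e 2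
    _ = (1 + L) ^ 2 * (‖v 0‖ + ‖v 1‖) ^ 2 := by ring
    _ ≤ (1 + L) ^ 2 * (2 * (‖v 0‖ ^ 2 + ‖v 1‖ ^ 2)) := by
        gcongr
        nlinarith [sq_nonneg (‖v 0‖ - ‖v 1‖)]
    _ = _ := by ring

theorem IsWeakSolution.integrable_horizSq {ε : ℝ} {S : ℝ → L2 D.dom}
    {u : ℝ → Fin 3 → H1Jet D.dom} {C : ℝ → H1Jet D.dom} (h : D.IsWeakSolution ε S u C) :
    Integrable (D.horizSq u C) (timeMeasure D.T) :=
  ((memLp_component h.velocity_memLp 0).norm.integrable_sq.add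
    (memLp_component h.velocity_memLp 1).norm.integrable_sq).add h.conc_memLp.norm.integrable_sq

theorem IsWeakSolution.integrable_dissipation {ε : ℝ} {S : ℝ → L2 D.dom}
    {u : ℝ → Fin 3 → H1Jet D.dom} {C : ℝ → H1Jet D.dom} (h : D.IsWeakSolution ε S u C) :
    Integrable (D.dissipation ε u C) (timeMeasure D.T) := by
  have hv (i : Fin 3) : Integrable (fun s => D.viscForm (u s i) (u s i)) (timeMeasure D.T) :=
    integrable_finsetSum _ fun k _ => (integrable_inner_of_memLp
      (memLp_grad (memLp_component h.velocity_memLp i) k)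
      (memLp_grad (memLp_component h.velocity_memLp i) k)).const_mul _
  refine ((integrable_finsetSum _ fun j _ => hv _).add ((hv 2).const_mul _)).add ?_
  exact integrable_finsetSum _ fun i _ => integrable_finsetSum _ fun j _ =>
    (integrable_inner_of_memLp (memLp_grad h.conc_memLp j) (memLp_grad h.conc_memLp i)).const_mul _

theorem IsWeakSolution.integrable_groundPairing (hD : D.Admissible) {ε : ℝ} {S : ℝ → L2 D.dom}
    {u : ℝ → Fin 3 → H1Jet D.dom} {C : ℝ → H1Jet D.dom} (h : D.IsWeakSolution ε S u C) :
    Integrable (fun s => D.groundPairing s (u s)) (timeMeasure D.T) := by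
  refine integrable_finsetSum _ fun j _ => ?_
  have h1 := (hD.ground j).memLp
  have h2 := memLp_component h.velocity_memLp j.castSucc
  refine Integrable.mono' (h1.norm.integrable_mul h2.norm) ?_
    (Eventually.of_forall fun t => (D.θ j t).le_opNorm _)
  exact (ContinuousLinearMap.id ℝ (StrongDual ℝ (H1Jet D.dom))).aestronglyMeasurable_comp₂
    h1.1 h2.1

/-- The bounds on the velocity and the concentration that follow from the energy inequality,
uniform in the aspect ratio. -/
theorem Admissible.exists_energy_bound (hD : D.Admissible) (ε₀ B : ℝ) (hB : 0 ≤ B) :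
    ∃ R : ℝ, 0 < R ∧ ∀ ε : ℝ, 0 < ε → ε ≤ ε₀ → ∀ S : ℝ → L2 D.dom,
      MemLp S 2 (timeMeasure D.T) → eLpNorm S 2 (timeMeasure D.T) ≤ ENNReal.ofReal B →
      ∀ (u : ℝ → Fin 3 → H1Jet D.dom) (C : ℝ → H1Jet D.dom),
        D.IsWeakSolution ε S u C → D.EnergyInequality ε S u C →
        (∀ᵐ t ∂(timeMeasure D.T), ‖val (C t)‖ ^ 2 ≤ R) ∧
          ∫ t, D.horizSq u C t ∂(timeMeasure D.T) ≤ R := by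
  obtain ⟨q, hq, hdiss⟩ := hD.exists_dissipation_ge
  set E₀ : ℝ := 1 / 2 * ((∑ j : Fin 2, ‖D.u₀ j.castSucc‖ ^ 2) + ε₀ ^ 2 * ‖D.u₀ 2‖ ^ 2 +
    ‖D.C₀‖ ^ 2) with hE₀
  have hE₀0 : 0 ≤ E₀ := by
    have := Finset.sum_nonneg fun j (_ : j ∈ (Finset.univ : Finset (Fin 2))) =>
      sq_nonneg ‖D.u₀ j.castSucc‖
    positivity
  set Θ : ℝ := (∫ t, ‖D.θ 0 t‖ ^ 2 ∂(timeMeasure D.T)) + ∫ t, ‖D.θ 1 t‖ ^ 2 ∂(timeMeasure D.T)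
    with hΘ
  have hΘ0 : 0 ≤ Θ :=
    add_nonneg (integral_nonneg fun _ => sq_nonneg _) (integral_nonneg fun _ => sq_nonneg _)
  set R₀ : ℝ := E₀ + 1 / q * (Θ + B ^ 2) with hR₀
  have hR₀0 : 0 ≤ R₀ := by positivity
  refine ⟨2 * R₀ + 2 * R₀ / q + 1, by positivity, fun ε hε hεε₀ S hS hSB u C hsol hen => ?_⟩
  have hT := hD.time_pos
  have iN := hsol.integrable_horizSq
  have iD := hsol.integrable_dissipation
  have iθ (j : Fin 2) : Integrable (fun t => ‖D.θ j t‖ ^ 2) (timeMeasure D.T) :=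
    (hD.ground j).memLp.norm.integrable_sq
  have iS : Integrable (fun t => ‖S t‖ ^ 2) (timeMeasure D.T) := hS.norm.integrable_sq
  have iG := (hsol.integrable_groundPairing hD).abs
  have iSC := integrable_inner_of_memLp hS (memLp_val hsol.conc_memLp)
  -- By Young's inequality the forcing is absorbed in a part of the dissipation.
  set P : ℝ → ℝ := fun s => ‖D.θ 0 s‖ ^ 2 + ‖D.θ 1 s‖ ^ 2 + ‖S s‖ ^ 2 with hP
  have iP : Integrable P (timeMeasure D.T) := ((iθ 0).add (iθ 1)).add iS
  have hforce (s : ℝ) : |D.groundPairing s (u s)| + inner ℝ (S s) (val (C s)) ≤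
      1 / q * P s + q / 4 * D.horizSq u C s := by
    have a0 : |D.θ 0 s (u s 0)| ≤ ‖D.θ 0 s‖ * ‖u s 0‖ := (D.θ 0 s).le_opNorm _
    have a1 : |D.θ 1 s (u s 1)| ≤ ‖D.θ 1 s‖ * ‖u s 1‖ := (D.θ 1 s).le_opNorm _
    have a2 : inner ℝ (S s) (val (C s)) ≤ ‖S s‖ * ‖C s‖ :=
      (real_inner_le_norm _ _).trans (by gcongr; exact norm_val_le _)
    have a3 : |D.groundPairing s (u s)| ≤ |D.θ 0 s (u s 0)| + |D.θ 1 s (u s 1)| := by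
      rw [groundPairing, Fin.sum_univ_two]
      exact abs_add_le _ _
    have b0 := mul_le_sq_div_add hq ‖D.θ 0 s‖ ‖u s 0‖
    have b1 := mul_le_sq_div_add hq ‖D.θ 1 s‖ ‖u s 1‖
    have b2 := mul_le_sq_div_add hq ‖S s‖ ‖C s‖
    simp only [hP, horizSq]
    linarith
  have hPint : ∫ t, P t ∂(timeMeasure D.T) ≤ Θ + B ^ 2 := by
    have h1 : Integrable (fun s => ‖D.θ 0 s‖ ^ 2 + ‖D.θ 1 s‖ ^ 2) (timeMeasure D.T) :=
      (iθ 0).add (iθ 1)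
    simp only [hP]
    rw [integral_add h1 iS, integral_add (iθ 0) (iθ 1)]
    have := (eLpNorm_two_le_ofReal_iff hS hB).1 hSB
    linarith
  have main : ∀ᵐ t ∂(timeMeasure D.T),
      1 / 2 * ‖val (C t)‖ ^ 2 + 3 * q / 4 * ∫ s in (0 : ℝ)..t, D.horizSq u C s ≤ R₀ := by
    have hd : ∀ᵐ s ∂(timeMeasure D.T), q * D.horizSq u C s ≤ D.dissipation ε u C s := by
      filter_upwards [hsol.velocity_mem, hsol.conc_mem] with s h1 h2 using hdiss ε u C s h1 h2
    filter_upwards [hen, ae_timeMeasure_mem D.T] with t het ht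
    have ii {f : ℝ → ℝ} (hf : Integrable f (timeMeasure D.T)) : IntervalIntegrable f volume 0 t :=
      intervalIntegrable_of_timeMeasure hf le_rfl ht.1.le ht.2.le
    have c1 : q * ∫ s in (0 : ℝ)..t, D.horizSq u C s ≤
        ∫ s in (0 : ℝ)..t, D.dissipation ε u C s := by
      rw [← intervalIntegral.integral_const_mul]
      refine intervalIntegral.integral_mono_ae_restrict ht.1.le (ii (iN.const_mul q)) (ii iD) ?_
      rw [← restrict_Ioo_eq_restrict_Icc]
      exact ae_mono (Measure.restrict_mono_set _ (Ioo_subset_Ioo_right ht.2.le)) hd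
    have c2 : (∫ s in (0 : ℝ)..t, |D.groundPairing s (u s)|) +
        (∫ s in (0 : ℝ)..t, inner ℝ (S s) (val (C s))) ≤
        1 / q * (∫ s in (0 : ℝ)..t, P s) + q / 4 * ∫ s in (0 : ℝ)..t, D.horizSq u C s := by
      rw [← intervalIntegral.integral_add (ii iG) (ii iSC), ← intervalIntegral.integral_const_mul,
        ← intervalIntegral.integral_const_mul,
        ← intervalIntegral.integral_add (ii (iP.const_mul _)) (ii (iN.const_mul _))]
      exact intervalIntegral.integral_mono ht.1.le ((ii iG).add (ii iSC))
        ((ii (iP.const_mul _)).add (ii (iN.const_mul _))) hforce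
    have c3 : ∫ s in (0 : ℝ)..t, P s ≤ Θ + B ^ 2 := by
      refine le_trans ?_ hPint
      rw [← intervalIntegral_eq_integral_timeMeasure hT.le]
      exact intervalIntegral.integral_mono_interval le_rfl ht.1.le ht.2.le
        (Eventually.of_forall fun s => by simp only [hP, Pi.zero_apply]; positivity)
        ((integrable_timeMeasure_iff_intervalIntegrable hT.le).1 iP)
    have c4 : 1 / q * (∫ s in (0 : ℝ)..t, P s) ≤ 1 / q * (Θ + B ^ 2) := by gcongr
    have c5 : 1 / 2 * ((∑ j : Fin 2, ‖D.u₀ j.castSucc‖ ^ 2) + ε ^ 2 * ‖D.u₀ 2‖ ^ 2 +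
        ‖D.C₀‖ ^ 2) ≤ E₀ := by
      rw [hE₀]
      gcongr
    have c6 : 0 ≤ (∑ j : Fin 2, ‖val (u t j.castSucc)‖ ^ 2) + ε ^ 2 * ‖val (u t 2)‖ ^ 2 := by
      have := Finset.sum_nonneg fun j (_ : j ∈ (Finset.univ : Finset (Fin 2))) =>
        sq_nonneg ‖val (u t j.castSucc)‖
      positivity
    change _ + ∫ s in (0 : ℝ)..t, D.dissipation ε u C s ≤ _ at het
    linarith
  constructor
  · filter_upwards [main, ae_timeMeasure_mem D.T] with t h ht
    have h1 : 0 ≤ ∫ s in (0 : ℝ)..t, D.horizSq u C s :=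
      intervalIntegral.integral_nonneg ht.1.le fun s _ => horizSq_nonneg u C s
    have h2 : 0 ≤ 2 * R₀ / q := by positivity
    have h3 : 0 ≤ 3 * q / 4 * ∫ s in (0 : ℝ)..t, D.horizSq u C s := by positivity
    linarith
  · refine integral_le_of_ae_intervalIntegral_le hT (horizSq_nonneg u C) iN ?_
    filter_upwards [main] with t h
    have h1 : 3 * q / 4 * ∫ s in (0 : ℝ)..t, D.horizSq u C s ≤ R₀ := by
      have := sq_nonneg ‖val (C t)‖
      linarith
    have h2 : ∫ s in (0 : ℝ)..t, D.horizSq u C s ≤ 2 * R₀ / q := by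
      rw [le_div_iff₀ hq]
      linarith
    linarith

/-- The bounds on the concentration and on `rate` that follow from the energy inequality. -/
theorem Admissible.exists_rate_bound (hD : D.Admissible) (ε₀ B : ℝ) (hB : 0 ≤ B) :
    ∃ R : ℝ, 0 < R ∧ ∀ ε : ℝ, 0 < ε → ε ≤ ε₀ → ∀ S : ℝ → L2 D.dom,
      MemLp S 2 (timeMeasure D.T) → eLpNorm S 2 (timeMeasure D.T) ≤ ENNReal.ofReal B →
      ∀ (u : ℝ → Fin 3 → H1Jet D.dom) (C : ℝ → H1Jet D.dom),
        D.IsWeakSolution ε S u C → D.EnergyInequality ε S u C →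
        eLpNorm C 2 (timeMeasure D.T) ≤ ENNReal.ofReal R ∧
          eLpNorm (D.rate S u C) 2 (timeMeasure D.T) ≤ ENNReal.ofReal R := by
  obtain ⟨R, hR, hbound⟩ := hD.exists_energy_bound ε₀ B hB
  obtain ⟨c, hc, hvel⟩ := hD.exists_velocity_le
  set Q : ℝ := 3 * (c * R + 1) * R + 3 * B ^ 2 + R + 1 with hQ
  have hQ1 : 1 ≤ Q := by
    have : 0 ≤ 3 * (c * R + 1) * R + 3 * B ^ 2 + R := by positivity
    linarith
  have hQ2 : Q ≤ Q ^ 2 := by nlinarith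
  refine ⟨Q, by linarith, fun ε hε hεε₀ S hS hSB u C hsol hen => ?_⟩
  obtain ⟨h1, h2⟩ := hbound ε hε hεε₀ S hS hSB u C hsol hen
  have iN := hsol.integrable_horizSq
  have iS : Integrable (fun t => ‖S t‖ ^ 2) (timeMeasure D.T) := hS.norm.integrable_sq
  rw [eLpNorm_two_le_ofReal_iff hsol.conc_memLp (by linarith),
    eLpNorm_two_le_ofReal_iff (hsol.memLp_rate hS) (by linarith)]
  have hCN (t : ℝ) : ‖C t‖ ^ 2 ≤ D.horizSq u C t := by
    unfold horizSq
    have := sq_nonneg ‖u t 0‖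
    have := sq_nonneg ‖u t 1‖
    linarith
  constructor
  · refine (integral_mono hsol.conc_memLp.norm.integrable_sq iN hCN).trans (h2.trans ?_)
    have : 0 ≤ 3 * (c * R + 1) * R + 3 * B ^ 2 := by positivity
    linarith
  · have hpt : ∀ᵐ t ∂(timeMeasure D.T), ‖D.rate S u C t‖ ^ 2 ≤
        3 * (c * R + 1) * D.horizSq u C t + 3 * ‖S t‖ ^ 2 := by
      filter_upwards [h1, hsol.velocity_mem] with t h3 h4
      have h5 := hvel _ h4
      set a := ∑ i, ‖val (u t i)‖
      have h6 : (a * ‖val (C t)‖) ^ 2 ≤ c * D.horizSq u C t * R := by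
        rw [mul_pow]
        have h7 : a ^ 2 ≤ c * D.horizSq u C t := by
          refine h5.trans (mul_le_mul_of_nonneg_left ?_ hc.le)
          exact le_add_of_nonneg_right (sq_nonneg _)
        exact mul_le_mul h7 h3 (sq_nonneg _) (mul_nonneg hc.le (horizSq_nonneg u C t))
      have h8 : ‖D.rate S u C t‖ ^ 2 ≤
          3 * ((a * ‖val (C t)‖) ^ 2 + ‖C t‖ ^ 2 + ‖S t‖ ^ 2) := by
        rw [Real.norm_eq_abs, sq_abs]
        change (a * ‖val (C t)‖ + ‖C t‖ + ‖S t‖) ^ 2 ≤ _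
        nlinarith [sq_nonneg (a * ‖val (C t)‖ - ‖C t‖), sq_nonneg (a * ‖val (C t)‖ - ‖S t‖),
          sq_nonneg (‖C t‖ - ‖S t‖)]
      have h9 := hCN t
      linarith
    refine (integral_mono_ae (hsol.memLp_rate hS).norm.integrable_sq
      ((iN.const_mul _).add (iS.const_mul 3)) hpt).trans ?_
    rw [integral_add' (iN.const_mul _) (iS.const_mul 3), integral_const_mul, integral_const_mul]
    have h10 := (eLpNorm_two_le_ofReal_iff hS hB).1 hSB
    have h11 : 3 * (c * R + 1) * ∫ t, D.horizSq u C t ∂(timeMeasure D.T) ≤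
        3 * (c * R + 1) * R := by gcongr
    linarith

end Data

/-! ### The time-translation estimate -/

theorem eLpNorm_shift_le {F : Type*} [NormedAddCommGroup F] {T h : ℝ} (h0 : 0 ≤ h) {f : ℝ → F}
    (hf : AEStronglyMeasurable f (timeMeasure T)) :
    AEStronglyMeasurable (fun t => f (t + h)) (timeMeasure (T - h)) ∧
      eLpNorm (fun t => f (t + h)) 2 (timeMeasure (T - h)) ≤ eLpNorm f 2 (timeMeasure T) := by
  have hmp := (measurePreserving_add_right volume h).restrict_preimage
    (measurableSet_Ioo (a := h) (b := T))
  rw [preimage_add_const_Ioo, sub_self] at hmp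
  have hle : volume.restrict (Ioo h T) ≤ timeMeasure T :=
    Measure.restrict_mono_set _ (Ioo_subset_Ioo_left h0)
  have hf' := hf.mono_measure hle
  exact ⟨hf'.comp_measurePreserving hmp,
    (eLpNorm_comp_measurePreserving hf' hmp).trans_le (eLpNorm_mono_measure f hle)⟩

/-- Integrating over a moving window of length `h` has norm at most `h` on `L²(ℝ)`. -/
theorem eLpNorm_window_integral_le {h : ℝ} (h0 : 0 ≤ h) {r : ℝ → ℝ}
    (hr : AEStronglyMeasurable r volume) :
    eLpNorm (fun t => ∫ s in t..(t + h), r s) 2 volume ≤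
      ENNReal.ofReal h * eLpNorm r 2 volume := by
  wlog hm : StronglyMeasurable r generalizing r
  · have h1 := this hr.stronglyMeasurable_mk.aestronglyMeasurable hr.stronglyMeasurable_mk
    rw [eLpNorm_congr_ae hr.ae_eq_mk]
    have h2 : (fun t => ∫ s in t..(t + h), r s) = fun t => ∫ s in t..(t + h), hr.mk r s := by
      funext t
      exact intervalIntegral.integral_congr_ae (hr.ae_eq_mk.mono fun _ hx _ => hx)
    rwa [h2]
  have hme : Measurable fun s => ‖r s‖ₑ := hm.measurable.enorm
  rw [eLpNorm_two_le_iff, mul_pow, eLpNorm_two_sq]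
  calc ∫⁻ t, ‖∫ s in t..(t + h), r s‖ₑ ^ 2
      ≤ ∫⁻ t, ENNReal.ofReal h * ∫⁻ s in Ioc 0 h, ‖r (s + t)‖ₑ ^ 2 := by
        refine lintegral_mono fun t => ?_
        have h1 : ∫ s in t..(t + h), r s = ∫ s in Ioc 0 h, r (s + t) := by
          rw [← intervalIntegral.integral_of_le h0, intervalIntegral.integral_comp_add_right,
            zero_add, add_comm]
        rw [h1]
        refine (pow_le_pow_left' (enorm_integral_le_lintegral_enorm _) 2).trans ?_
        refine (sq_lintegral_le (hme.comp (measurable_add_const t)).aemeasurable).trans ?_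
        simp
    _ = ENNReal.ofReal h * ∫⁻ s in Ioc 0 h, ∫⁻ t, ‖r (s + t)‖ₑ ^ 2 := by
        rw [lintegral_const_mul' _ _ ENNReal.ofReal_ne_top, lintegral_lintegral_swap]
        exact ((hme.comp (measurable_snd.add measurable_fst)).pow_const 2).aemeasurable
    _ = ENNReal.ofReal h ^ 2 * ∫⁻ t, ‖r t‖ₑ ^ 2 := by
        simp only [lintegral_add_left_eq_self (fun t => ‖r t‖ₑ ^ 2)]
        rw [setLIntegral_const, Real.volume_Ioc, sub_zero]
        ring

theorem eLpNorm_le_of_norm_le {F G : Type*} [SeminormedAddCommGroup F] [SeminormedAddCommGroup G]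
    {f : ℝ → F} {g : ℝ → G} {μ : Measure ℝ} (h : ∀ t, ‖f t‖ ≤ ‖g t‖) :
    eLpNorm f 2 μ ≤ eLpNorm g 2 μ :=
  eLpNorm_mono_enorm fun t => by
    simp only [← ofReal_norm]
    exact ENNReal.ofReal_le_ofReal (h t)

theorem norm_toH2Dual_le {Ω : Set E3} (w : L2 Ω) : ‖toH2Dual w‖ ≤ ‖w‖ := by
  refine ContinuousLinearMap.opNorm_le_bound _ (norm_nonneg _) fun φ => ?_
  change ‖(inner ℝ w (val₂ (φ : H2Jet Ω)) : ℝ)‖ ≤ _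
  refine (norm_inner_le_norm _ _).trans ?_
  gcongr
  exact PiLp.norm_apply_le (φ : H2Jet Ω) none

theorem eLpNorm_toH2Dual_le {Ω : Set E3} (w : ℝ → L2 Ω) (μ : Measure ℝ) :
    eLpNorm (fun t => toH2Dual (w t)) 2 μ ≤ eLpNorm w 2 μ := by
  have h := eLpNorm_le_of_norm_le (f := fun t => toH2Dual (w t)) (g := w) (μ := μ)
    fun t => norm_toH2Dual_le (w t)
  exact h

theorem sub_mem_H1Vanishing {Ω Γ : Set E3} {J J' : H1Jet Ω} (hJ : J ∈ H1Vanishing Ω Γ)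
    (hJ' : J' ∈ H1Vanishing Ω Γ) : J - J' ∈ H1Vanishing Ω Γ := by
  refine map_mem_closure₂ continuous_sub hJ hJ' ?_
  rintro J ⟨φ, ⟨hφ, U, hU, hΓU, h0⟩, hJ0, hJ1⟩ J' ⟨φ', ⟨hφ', U', hU', hΓU', h0'⟩, hJ0', hJ1'⟩
  refine ⟨fun x => φ x - φ' x, ⟨hφ.sub hφ', U ∩ U', hU.inter hU', subset_inter hΓU hΓU',
    fun x hx => ?_⟩, ?_, fun i => ?_⟩
  · simp [h0 x ⟨hx.1.1, hx.2⟩, h0' x ⟨hx.1.2, hx.2⟩]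
  · filter_upwards [hJ0, hJ0', Lp.coeFn_sub (val J) (val J')] with x h1 h2 h3
    exact h3.trans (by simp [h1, h2])
  · filter_upwards [hJ1 i, hJ1' i, Lp.coeFn_sub (grad J i) (grad J' i)] with x h1 h2 h3
    refine h3.trans ?_
    have d1 := (hφ.differentiable (by simp)).differentiableAt (x := x)
    have d2 := (hφ'.differentiable (by simp)).differentiableAt (x := x)
    simp only [Pi.sub_apply, h1, h2, pderiv]
    rw [fderiv_fun_sub d1 d2]
    rfl

namespace Data

variable {D : Data}

/-- Smooth approximation in `H¹_{Γ_A}(Ω)`, with rates. -/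
theorem Admissible.exists_regularization (hD : D.Admissible) :
    ∃ c η₀ : ℝ, 0 < c ∧ 0 < η₀ ∧ ∀ η : ℝ, 0 < η → η ≤ η₀ → ∀ J ∈ D.H1A,
      ∃ φ : E3 → ℝ, IsSmoothVanishingNear D.dom (aboveBdry D.G D.d) φ ∧
        (∀ x, |φ x| ≤ c / η ^ 5 * ‖val J‖) ∧ (∀ i x, |pderiv i φ x| ≤ c / η ^ 5 * ‖val J‖) ∧
        eLpNorm (fun x => φ x - val J x) 2 (volume.restrict D.dom) ≤
          ENNReal.ofReal (c * η ^ 2 * ‖J‖) := by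
  obtain ⟨K, hK⟩ := hD.lipschitz_height
  obtain ⟨A, δ₀, hA, hδ₀, hexit⟩ := exists_exit_directions hD.lipschitz_base hK
  obtain ⟨c, hc, h⟩ := PollutedAtmosphere.exists_regularization hD.isOpen_dom hD.coversUpperBdry
    D.dom_subset_upperHalf hA hexit
  refine ⟨c, min 1 δ₀, hc, lt_min one_pos hδ₀, fun η hη hη' => ?_⟩
  have h1 : η ≤ 1 := hη'.trans (min_le_left _ _)
  refine h η hη h1 (le_trans ?_ (hη'.trans (min_le_right _ _)))
  rw [pow_two]
  exact mul_le_of_le_one_left hη.le h1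

/-- Interpolation between `H¹_{Γ_A}(Ω)` and the weak bound for the increments: the increment of
the concentration is tested against smooth approximations of itself. -/
theorem Admissible.exists_norm_increment_le (hD : D.Admissible) :
    ∃ c η₀ : ℝ, 0 < c ∧ 0 < η₀ ∧ ∀ (ε : ℝ) (S : ℝ → L2 D.dom) (u : ℝ → Fin 3 → H1Jet D.dom)
      (C : ℝ → H1Jet D.dom), D.IsWeakSolution ε S u C → MemLp S 2 (timeMeasure D.T) →
      ∀ h : ℝ, 0 < h → h < D.T → ∀ η : ℝ, 0 < η → η ≤ η₀ → ∀ᵐ t ∂(timeMeasure (D.T - h)),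
        ‖val (C (t + h)) - val (C t)‖ ≤ c * η ^ 2 * (‖C (t + h)‖ + ‖C t‖) +
          c / η ^ 5 * ∫ s in t..(t + h), D.rate S u C s := by
  obtain ⟨c, η₀, hc, hη₀, hreg⟩ := hD.exists_regularization
  obtain ⟨K, hK, hinc⟩ := hD.exists_increment_bound
  refine ⟨c + c * K, η₀, by positivity, hη₀, fun ε S u C hsol hS h h0 hT η hη hη' => ?_⟩
  obtain ⟨Z, hZ, hCZ⟩ := hsol.conc_memLp.1.isSeparable_ae_range
  -- The increments lie in a separable set; almost everywhere in time, the weak bound is used for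
  -- countably many test functions, those attached to a dense sequence of that set.
  have hsep : TopologicalSpace.IsSeparable ((fun p : H1Jet D.dom × H1Jet D.dom => p.1 - p.2) ''
      (Z ×ˢ Z) ∩ D.H1A) := ((hZ.prod hZ).image continuous_sub).mono inter_subset_left
  obtain ⟨Q, hQsub, hQc, hQd⟩ := hsep.exists_countable_dense_subset
  choose! φ hφ1 hφ2 hφ3 hφ4 using fun J (hJ : J ∈ D.H1A) => hreg η hη hη' J hJ
  have htest : ∀ J ∈ Q, ∃ ψ : L2 D.dom, ‖ψ - val J‖ ≤ c * η ^ 2 * ‖J‖ ∧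
      ∀ᵐ t ∂(timeMeasure (D.T - h)), |inner ℝ (val (C (t + h)) - val (C t)) ψ| ≤
        c / η ^ 5 * ‖val J‖ * ∫ s in t..(t + h), K * D.rate S u C s := by
    intro J hJ
    have hJA := (hQsub hJ).2
    obtain ⟨ψ, hψ, hψt⟩ := hinc ε S u C hsol hS h h0 hT (φ J) (c / η ^ 5 * ‖val J‖)
      (by positivity) (hφ1 J hJA) (hφ2 J hJA) (hφ3 J hJA)
    refine ⟨ψ, ?_, hψt⟩
    rw [Lp.norm_def]
    refine ENNReal.toReal_le_of_le_ofReal (by positivity) ((hφ4 J hJA).trans_eq' ?_)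
    refine eLpNorm_congr_ae ?_
    filter_upwards [hψ, Lp.coeFn_sub ψ (val J)] with x h1 h2
    rw [h2, Pi.sub_apply, h1]
  choose! ψ hψ1 hψ2 using htest
  have hψall := (ae_ball_iff hQc).2 hψ2
  filter_upwards [hψall, ae_timeMeasure_mono (by linarith) hCZ, ae_timeMeasure_shift h0.le hCZ,
    ae_timeMeasure_mono (by linarith) hsol.conc_mem, ae_timeMeasure_shift h0.le hsol.conc_mem]
    with t ht z1 z2 m1 m2
  set w : H1Jet D.dom := C (t + h) - C t with hw
  have hval : val (C (t + h)) - val (C t) = val w := rfl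
  rw [hval] at ht ⊢
  set I : ℝ := ∫ s in t..(t + h), D.rate S u C s with hI
  have hI0 : 0 ≤ I := intervalIntegral.integral_nonneg (by linarith) fun s _ => rate_nonneg S u C s
  have hwQ : w ∈ closure Q := hQd ⟨⟨(C (t + h), C t), ⟨z2, z1⟩, rfl⟩, sub_mem_H1Vanishing m2 m1⟩
  have hvc : Continuous (val : H1Jet D.dom → L2 D.dom) := (valL (Ω := D.dom)).continuous
  have hclosed : IsClosed {J : H1Jet D.dom | ‖val w‖ ^ 2 ≤ ‖val w‖ * ‖val w - val J‖ +
      ‖val w‖ * (c * η ^ 2 * ‖J‖) + c / η ^ 5 * ‖val J‖ * (K * I)} :=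
    isClosed_le continuous_const (by fun_prop)
  have hsubQ : Q ⊆ {J : H1Jet D.dom | ‖val w‖ ^ 2 ≤ ‖val w‖ * ‖val w - val J‖ +
      ‖val w‖ * (c * η ^ 2 * ‖J‖) + c / η ^ 5 * ‖val J‖ * (K * I)} := by
    intro J hJ
    have h1 := ht J hJ
    rw [intervalIntegral.integral_const_mul] at h1
    have h2 : ‖val w‖ ^ 2 = inner ℝ (val w) (val w - val J) + inner ℝ (val w) (val J - ψ J) +
        inner ℝ (val w) (ψ J) := by
      rw [← inner_add_right, ← inner_add_right, sub_add_sub_cancel, sub_add_cancel,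
        real_inner_self_eq_norm_sq]
    have h3 : inner ℝ (val w) (val J - ψ J) ≤ ‖val w‖ * (c * η ^ 2 * ‖J‖) := by
      refine (real_inner_le_norm _ _).trans ?_
      rw [norm_sub_rev]
      gcongr
      exact hψ1 J hJ
    rw [mem_ofPred_eq, h2]
    exact add_le_add (add_le_add (real_inner_le_norm _ _) h3) ((le_abs_self _).trans h1)
  have key : ‖val w‖ ^ 2 ≤ ‖val w‖ * ‖val w - val w‖ + ‖val w‖ * (c * η ^ 2 * ‖w‖) +
      c / η ^ 5 * ‖val w‖ * (K * I) := closure_minimal hsubQ hclosed hwQ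
  rw [sub_self, norm_zero, mul_zero, zero_add] at key
  have hwn : ‖w‖ ≤ ‖C (t + h)‖ + ‖C t‖ := norm_sub_le _ _
  have key2 : ‖val w‖ ≤ c * η ^ 2 * ‖w‖ + c / η ^ 5 * (K * I) := by
    rcases (norm_nonneg (val w)).eq_or_lt with h1 | h1
    · rw [← h1]
      positivity
    · refine le_of_mul_le_mul_left ?_ h1
      linarith
  refine key2.trans (add_le_add ?_ ?_)
  · gcongr
    have : 0 ≤ c * K := by positivity
    linarith
  · calc c / η ^ 5 * (K * I) = c * K / η ^ 5 * I := by ring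
      _ ≤ (c + c * K) / η ^ 5 * I := by gcongr; linarith

/-- The pointwise bound of `exists_norm_increment_le`, integrated in time. -/
theorem IsWeakSolution.eLpNorm_increment_le {ε R c η h : ℝ} {S : ℝ → L2 D.dom}
    {u : ℝ → Fin 3 → H1Jet D.dom} {C : ℝ → H1Jet D.dom} (hsol : D.IsWeakSolution ε S u C)
    (hS : MemLp S 2 (timeMeasure D.T)) (hR : 0 < R) (hc : 0 < c) (hη : 0 < η) (h0 : 0 < h)
    (hC : eLpNorm C 2 (timeMeasure D.T) ≤ ENNReal.ofReal R)
    (hr : eLpNorm (D.rate S u C) 2 (timeMeasure D.T) ≤ ENNReal.ofReal R)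
    (hpt : ∀ᵐ t ∂(timeMeasure (D.T - h)), ‖val (C (t + h)) - val (C t)‖ ≤
      c * η ^ 2 * (‖C (t + h)‖ + ‖C t‖) + c / η ^ 5 * ∫ s in t..(t + h), D.rate S u C s) :
    eLpNorm (fun t => val (C (t + h)) - val (C t)) 2 (timeMeasure (D.T - h)) ≤
      ENNReal.ofReal (c * η ^ 2 * (R + R) + c / η ^ 5 * (h * R)) := by
  set μ := timeMeasure (D.T - h) with hμ
  set r : ℝ → ℝ := (Ioo 0 D.T).indicator (D.rate S u C) with hrdef
  have hrm : AEStronglyMeasurable r volume :=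
    (aestronglyMeasurable_indicator_iff measurableSet_Ioo).2 (hsol.memLp_rate hS).1
  have hr2 : eLpNorm r 2 volume ≤ ENNReal.ofReal R := by
    rw [hrdef, eLpNorm_indicator_eq_eLpNorm_restrict measurableSet_Ioo]
    exact hr
  have hri : Integrable r volume :=
    (integrable_indicator_iff measurableSet_Ioo).2 ((hsol.memLp_rate hS).integrable one_le_two)
  have hW := (eLpNorm_window_integral_le h0.le hrm).trans (mul_le_mul_right hr2 _)
  rw [← ENNReal.ofReal_mul h0.le] at hW
  have hWc : Continuous fun t => ∫ s in t..(t + h), r s := by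
    have e : (fun t => ∫ s in t..(t + h), r s) =
        fun t => (∫ s in (0 : ℝ)..(t + h), r s) - ∫ s in (0 : ℝ)..t, r s := by
      funext t
      rw [intervalIntegral.integral_interval_sub_left hri.intervalIntegrable
        hri.intervalIntegrable]
    have hp := intervalIntegral.continuous_primitive (fun a b => hri.intervalIntegrable) 0
    rw [e]
    exact (hp.comp (continuous_add_const h)).sub hp
  obtain ⟨hCm, hCs⟩ := eLpNorm_shift_le h0.le hsol.conc_memLp.1
  have hle : μ ≤ timeMeasure D.T :=
    Measure.restrict_mono_set _ (Ioo_subset_Ioo_right (by linarith))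
  have hCm' := hsol.conc_memLp.1.mono_measure hle
  have hCn : eLpNorm (fun t => ‖C (t + h)‖ + ‖C t‖) 2 μ ≤ ENNReal.ofReal (R + R) := by
    rw [ENNReal.ofReal_add hR.le hR.le]
    refine (eLpNorm_add_le hCm.norm hCm'.norm one_le_two).trans (add_le_add ?_ ?_)
    · rw [eLpNorm_norm]
      exact hCs.trans hC
    · rw [eLpNorm_norm]
      exact (eLpNorm_mono_measure _ hle).trans hC
  calc eLpNorm (fun t => val (C (t + h)) - val (C t)) 2 μ
      ≤ eLpNorm ((c * η ^ 2) • (fun t => ‖C (t + h)‖ + ‖C t‖) +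
          (c / η ^ 5) • fun t => ∫ s in t..(t + h), r s) 2 μ := by
        refine eLpNorm_mono_ae_real ?_
        filter_upwards [hpt, ae_timeMeasure_mem (D.T - h)] with t h1 h2
        refine h1.trans_eq ?_
        have e : ∫ s in t..(t + h), D.rate S u C s = ∫ s in t..(t + h), r s := by
          refine intervalIntegral.integral_congr fun s hs => ?_
          rw [uIcc_of_le (by linarith)] at hs
          exact (indicator_of_mem (show s ∈ Ioo 0 D.T from
            ⟨h2.1.trans_le hs.1, by linarith [hs.2, h2.2]⟩) _).symm
        rw [e]
        simp
    _ ≤ ENNReal.ofReal (c * η ^ 2) * ENNReal.ofReal (R + R) +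
          ENNReal.ofReal (c / η ^ 5) * ENNReal.ofReal (h * R) := by
        refine (eLpNorm_add_le ((hCm.norm.add hCm'.norm).const_smul _)
          (hWc.aestronglyMeasurable.const_smul _) one_le_two).trans (add_le_add ?_ ?_)
        · rw [eLpNorm_const_smul, Real.enorm_of_nonneg (by positivity)]
          exact mul_le_mul' le_rfl hCn
        · rw [eLpNorm_const_smul, Real.enorm_of_nonneg (by positivity)]
          exact mul_le_mul' le_rfl
            ((eLpNorm_mono_measure _ Measure.restrict_le_self).trans hW)
    _ = _ := by
        rw [← ENNReal.ofReal_mul (by positivity), ← ENNReal.ofReal_mul (by positivity),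
          ENNReal.ofReal_add (by positivity) (by positivity)]

end Data

end PollutedAtmosphere

theorem mainTheorem3 (D : PollutedAtmosphere.Data) (hD : D.Admissible)
    (ε₀ B : ℝ) (hε₀ : 0 < ε₀) (hB : 0 ≤ B) :
    ∃ c : ℝ, 0 < c ∧
      ∀ ε : ℝ, 0 < ε → ε ≤ ε₀ →
      ∀ S : ℝ → PollutedAtmosphere.L2 D.dom,
        MemLp S 2 (PollutedAtmosphere.timeMeasure D.T) →
        eLpNorm S 2 (PollutedAtmosphere.timeMeasure D.T) ≤ ENNReal.ofReal B →
      ∀ (u : ℝ → Fin 3 → PollutedAtmosphere.H1Jet D.dom) (C : ℝ → PollutedAtmosphere.H1Jet D.dom),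
        D.IsWeakSolution ε S u C → D.EnergyInequality ε S u C →
      ∀ h : ℝ, 0 < h → h < D.T →
        eLpNorm (fun t => PollutedAtmosphere.toH2Dual
            (PollutedAtmosphere.val (C (t + h)) - PollutedAtmosphere.val (C t))) 2
          (PollutedAtmosphere.timeMeasure (D.T - h))
        ≤ ENNReal.ofReal (c * h ^ (1 / 4 : ℝ)) := by
  obtain ⟨R, hR, hbound⟩ := hD.exists_rate_bound ε₀ B hB
  obtain ⟨c, η₀, hc, hη₀, hinc⟩ := hD.exists_norm_increment_le
  have hT := hD.time_pos
  set A : ℝ := c * η₀ ^ 2 * (R + R) + c / η₀ ^ 5 * (D.T * R) with hA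
  have hA0 : 0 < A := by positivity
  refine ⟨A / D.T ^ (1 / 4 : ℝ), by positivity,
    fun ε hε hεε₀ S hS hSB u C hsol hen h h0 hhT => ?_⟩
  obtain ⟨hC, hr⟩ := hbound ε hε hεε₀ S hS hSB u C hsol hen
  -- The scale of the regularization is `η ^ 2`, of order `h ^ (1 / 4)`.
  set x : ℝ := (h / D.T) ^ (1 / 8 : ℝ) with hx
  have hhT0 : 0 < h / D.T := by positivity
  have hx0 : 0 < x := by positivity
  have hx1 : x ≤ 1 := Real.rpow_le_one hhT0.le ((div_le_one hT).2 hhT.le) (by norm_num)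
  have hx8 : h = D.T * x ^ 8 := by
    rw [hx, ← Real.rpow_natCast, ← Real.rpow_mul hhT0.le]
    norm_num
    field_simp
  have hx2 : x ^ 2 = h ^ (1 / 4 : ℝ) / D.T ^ (1 / 4 : ℝ) := by
    rw [hx, ← Real.rpow_natCast, ← Real.rpow_mul hhT0.le, ← Real.div_rpow h0.le hT.le]
    norm_num
  have hη : 0 < η₀ * x := by positivity
  have hη' : η₀ * x ≤ η₀ := mul_le_of_le_one_right hη₀.le hx1
  refine (PollutedAtmosphere.eLpNorm_toH2Dual_le _ _).trans ?_
  refine (hsol.eLpNorm_increment_le hS hR hc hη h0 hC hr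
    (hinc ε S u C hsol hS h h0 hhT _ hη hη')).trans (ENNReal.ofReal_le_ofReal ?_)
  calc c * (η₀ * x) ^ 2 * (R + R) + c / (η₀ * x) ^ 5 * (h * R)
      = c * η₀ ^ 2 * (R + R) * x ^ 2 + c / η₀ ^ 5 * (D.T * R) * x ^ 3 := by
        conv_lhs => rw [hx8]
        field_simp
    _ ≤ c * η₀ ^ 2 * (R + R) * x ^ 2 + c / η₀ ^ 5 * (D.T * R) * x ^ 2 := by
        refine add_le_add le_rfl (mul_le_mul_of_nonneg_left ?_ (by positivity))
        exact pow_le_pow_of_le_one hx0.le hx1 (Nat.le_succ 2)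
    _ = A / D.T ^ (1 / 4 : ℝ) * h ^ (1 / 4 : ℝ) := by
        rw [← add_mul, ← hA, hx2]
        ring
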